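/- Let $n\ge 2$, $t_0\in\mathbb R$, $a_0,\dots,a_{n-1}\in\mathbb C$, and let $r_0,\dots,r_{n-1}:[t_0,\infty)\to\mathbb C$ be locally integrable. Consider the equation $$y^{(n)}(t)+\sum_{i=0}^{n-1}(a_i+r_i(t))\,y^{(i)}(t)=0\quad\text{on }[t_0,\infty),\qquad(1)$$ where a solution is a function $y\in C^{n-1}[t_0,\infty)$ with $y^{(n-1)}$ locally absolutely continuous that satisfies (1) almost everywhere. Assume that the polynomial $P(a;x)=x^n+\sum_{i=0}^{n-1}a_ix^i$ has $n$ roots $\lambda,\lambda_1,\dots,\lambda_{n-1}$ with pairwise different real parts, and write $P(r(t);x)=\sum_{i=0}^{n-1}r_i(t)x^i$, $$\gamma_j=\lambda_j-\lambda,\quad \alpha_j=\operatorname{Re}\gamma_j,\quad \tilde\alpha_j=\sum_{i=0}^{n-2}|\gamma_j|^i,\quad \Gamma_j=\prod_{1\le k\le n-1,\;k\neq j}(\gamma_j-\gamma_k),\qquad j=1,\dots,n-1.$$ For $\omega\in\mathbb C$ with $\operatorname{Re}\omega\ne0$ and $f$ locally integrable on $[t_0,\infty)$ put $$I_\omega[f](t)=\int_{t_0}^\infty|g_\omega(t,s)f(s)|\,ds\in[0,\infty],\qquad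 g_\omega(t,s)=\begin{cases}-\operatorname{sgn}(\operatorname{Re}\omega)\,e^{\omega(t-s)}&\text{if }\operatorname{sgn}(\operatorname{Re}\omega)(t-s)<0,\\0&\text{otherwise,}\end{cases}$$ and let $\|\cdot\|_\infty$ be the supremum over $[t_0,\infty)$. **Theorem (Levinson type).** Suppose that $P(r;\lambda)\in L^1[t_0,\infty)$ and that $0<\beta<\min_{1\le j\le n-1}|\alpha_j|$ satisfies $$\sum_{j=1}^{n-1}\sum_{k=1}^{n-1}\frac{\tilde\alpha_j}{k!\,|\Gamma_j|}\left\|I_{\alpha_j-\operatorname{sgn}(\alpha_j)\beta}\Big[\frac{\partial^k}{\partial x^k}P(r(\cdot);x)\Big|_{x=\lambda}\Big]\right\|_\infty<\frac12.\qquad(2)$$ Then (1) has a solution $y_\lambda$ on $[t_0,\infty)$, without zeros for all large $t$, such that $$\lim_{t\to+\infty}\frac{y_\lambda^{(i)}(t)}{y_\lambda(t)}=\lambda^i,\qquad i=1,\dots,n-1,$$ and, as $t\to+\infty$, $$y_\lambda(t)=\Big[1+O\Big(\int_t^{+\infty}(I_\beta+I_{-\beta})[P(r;\lambda)](s)\,ds\Big)\Big]e^{\lambda(t-t_0)},$$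 $$\frac{y_\lambda^{(i)}(t)}{y_\lambda(t)}=\lambda^i+O\big((I_\beta+I_{-\beta})[P(r;\lambda)](t)\big),\qquad i=1,\dots,n-1.$$ -/

import Mathlib

open MeasureTheory Filter Asymptotics Set
open scoped ENNReal Topology Polynomial

namespace PoincarePerron

noncomputable section

/-- The polynomial `P(c;x) = ∑ᵢ cᵢ xⁱ` with coefficient tuple `c = (c₀, …, c_{m-1})`. -/
def coeffPoly {m : ℕ} (c : Fin m → ℂ) : ℂ[X] :=
  ∑ i : Fin m, Polynomial.C (c i) * Polynomial.X ^ (i : ℕ)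

/-- The characteristic polynomial `P(a;x) = xⁿ + ∑_{i<n} aᵢ xⁱ` of the unperturbed equation. -/
def charPoly {n : ℕ} (a : Fin n → ℂ) : ℂ[X] :=
  Polynomial.X ^ n + coeffPoly a

/-- The function `t ↦ ∂ᵏ/∂xᵏ P(r(t);x)` evaluated at `x = lam`, where
`P(r(t);x) = ∑_{i<n} rᵢ(t) xⁱ`; for `k = 0` it is `P(r(t);lam)`. -/
def pertDeriv {n : ℕ} (r : Fin n → ℝ → ℂ) (lam : ℂ) (k : ℕ) (t : ℝ) : ℂ :=
  (Polynomial.derivative^[k] (coeffPoly fun i => r i t)).eval lam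

/-- The scalar Green kernel `g_ω(t,s)`, equal to `-sgn(Re ω) e^{ω(t-s)}` when
`sgn(Re ω)(t-s) < 0` and to `0` otherwise. -/
def greenKernel (ω : ℂ) (t s : ℝ) : ℂ :=
  if Real.sign ω.re * (t - s) < 0 then
    -(Real.sign ω.re : ℂ) * Complex.exp (ω * ((t : ℂ) - (s : ℂ)))
  else 0

/-- The operator `I_ω[f](t) = ∫_{t₀}^∞ |g_ω(t,s) f(s)| ds`, with values in `[0,∞]`. -/
def greenInt (t₀ : ℝ) (ω : ℂ) (f : ℝ → ℂ) (t : ℝ) : ℝ≥0∞ :=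
  ∫⁻ s in Ici t₀, ‖greenKernel ω t s * f s‖ₑ

/-- `(I_β + I_{-β})[f](t)`, with values in `[0,∞]`. -/
def dichInt (t₀ β : ℝ) (f : ℝ → ℂ) (t : ℝ) : ℝ≥0∞ :=
  greenInt t₀ (β : ℂ) f t + greenInt t₀ (-β : ℂ) f t

/-- `Γⱼ = ∏_{k ≠ j} (γⱼ - γ_k)`. -/
def gammaProd {m : ℕ} (γ : Fin m → ℂ) (j : Fin m) : ℂ :=
  ∏ k ∈ Finset.univ.erase j, (γ j - γ k)

/-- `∑_{i<m} |γⱼ|ⁱ`; with `m = n - 1` the summation range is `0 ≤ i ≤ n - 2`. -/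
def alphaTilde {m : ℕ} (γ : Fin m → ℂ) (j : Fin m) : ℝ :=
  ∑ i ∈ Finset.range m, ‖γ j‖ ^ i

/-- The smallness quantity
`∑_{j=1}^{n-1} ∑_{k=1}^{n-1} α̃ⱼ / (k! |Γⱼ|) ‖I_{αⱼ - sgn(αⱼ) β}[∂ᵏ/∂xᵏ P(r;lam)]‖_∞`,
with `αⱼ = Re γⱼ`; the norm is the supremum over `[t₀,∞)`, in `[0,∞]`. -/
def smallness {n : ℕ} (t₀ : ℝ) (r : Fin n → ℝ → ℂ) (lam : ℂ) (γ : Fin (n - 1) → ℂ)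
    (β : ℝ) : ℝ≥0∞ :=
  ∑ j : Fin (n - 1), ∑ k ∈ Finset.Icc 1 (n - 1),
    ENNReal.ofReal (alphaTilde γ j / ((k.factorial : ℝ) * ‖gammaProd γ j‖)) *
      ⨆ t ∈ Ici t₀,
        greenInt t₀ (((γ j).re - Real.sign (γ j).re * β : ℝ) : ℂ) (pertDeriv r lam k) t

/-- `y` solves `y⁽ⁿ⁾ + ∑_{i<n} (aᵢ + rᵢ(t)) y⁽ⁱ⁾ = 0` on `[t₀,∞)` in the sense of Carathéodory:
`y` is of class `C^{n-1}`, its derivative of order `n - 1` is locally absolutely continuous, and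
the equation holds almost everywhere. (The derivatives at `t₀` are one-sided.) -/
structure IsSolution {n : ℕ} (a : Fin n → ℂ) (r : Fin n → ℝ → ℂ) (t₀ : ℝ) (y : ℝ → ℂ) :
    Prop where
  contDiffOn : ContDiffOn ℝ ((n - 1 : ℕ) : WithTop ℕ∞) y (Ici t₀)
  absCont : ∀ T : ℝ, t₀ ≤ T →
    AbsolutelyContinuousOnInterval (iteratedDerivWithin (n - 1) y (Ici t₀)) t₀ T
  eqn : ∀ᵐ t ∂(volume.restrict (Ici t₀)),
    iteratedDerivWithin n y (Ici t₀) t +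
      ∑ i : Fin n, (a i + r i t) * iteratedDerivWithin (i : ℕ) y (Ici t₀) t = 0

end

end PoincarePerron

open PoincarePerron

/-! Write `y = e^{λ(t-t₀)} u` and `m = n-1`. As `λ` is a characteristic root, undifferentiated `u`
survives only in the term `P(r;λ) u`. So `v = u'` solves an equation of order `m` with
characteristic roots `γⱼ` and right-hand side `h = -(P(r;λ) u + ∑ₖ ∂ᵏP(r;λ)/k! · v^{(k-1)})`, `1 ≤ k
≤ m`. Partial fractions of `1/∏(x-γⱼ)` (`sum_div_gammaProd`) split `v = ∑ xⱼ` with `xⱼ' = γⱼ xⱼ +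
h/Γⱼ` and `v^{(i)} = ∑ γⱼⁱ xⱼ` for `i < m`. No `γⱼ` is purely imaginary, so each `xⱼ` can be taken
as a Green integral of `h`. With the normalisation `u = 1 - ∫_t^∞ v` this is a fixed point equation
for `V = (v, …, v^{(m-1)})`.

The equation is solved among functions bounded by a multiple of `w(t) = ∫ e^{-β|t-s|} |q(s)| ds`,
where `q` is `P(r;λ)` cut off to the left of a large `T`. By the triangle inequality
(`enorm_greenKernel_mul_expKernel_le`), moving `w` out of a Green integral costs only the shift of
`αⱼ` by `β` towards zero. Hence (2) says that the terms in `v^{(k-1)}` have weighted norm at most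
`1/2`. The term in `u` contributes at most `1/4`, because `∫ w ≤ C ∫_T^∞ |P(r;λ)|` is small for
large `T`. Altogether the operator contracts by `3/4` (`GreenData.exists_fixedPoint`).

Since `w ≤ (I_β + I_{-β})[P(r;λ)]`, the weighted bound on the fixed point already contains both
error estimates. The fixed point solves the true equation only to the right of `T`; linearity allows
continuation back to `t₀` (`exists_extension`). -/

namespace PoincarePerron

open scoped NNReal

/-! ### Indefinite integrals and Carathéodory solutions -/

/-- `F` is an indefinite integral of the locally integrable function `f`. -/
structure IsPrimitive {E : Type*} [NormedAddCommGroup E] [NormedSpace ℝ E]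
    (F f : ℝ → E) : Prop where
  locallyIntegrable : LocallyIntegrable f
  sub_eq : ∀ a b : ℝ, F b - F a = ∫ s in a..b, f s

theorem _root_.MeasureTheory.LocallyIntegrable.intervalIntegrable {E : Type*}
    [NormedAddCommGroup E] {f : ℝ → E} (hf : LocallyIntegrable f) (a b : ℝ) :
    IntervalIntegrable f volume a b :=
  intervalIntegrable_iff.mpr
    ((hf.integrableOn_isCompact isCompact_uIcc).mono_set uIoc_subset_uIcc)

namespace IsPrimitive

variable {E : Type*} [NormedAddCommGroup E] [NormedSpace ℝ E] {F G f g : ℝ → E}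

theorem eq_add (h : IsPrimitive F f) (a b : ℝ) : F b = F a + ∫ s in a..b, f s := by
  rw [← h.sub_eq a b]; abel

theorem continuous (h : IsPrimitive F f) : Continuous F := by
  have h1 : F = fun t => F 0 + ∫ s in (0 : ℝ)..t, f s := funext fun t => h.eq_add 0 t
  rw [h1]
  exact continuous_const.add
    (intervalIntegral.continuous_primitive (fun a b => h.1.intervalIntegrable a b) 0)

theorem ae_hasDerivAt [CompleteSpace E] (h : IsPrimitive F f) :
    ∀ᵐ t, HasDerivAt F (f t) t := by
  have h1 : F = fun t => F 0 + ∫ s in (0 : ℝ)..t, f s := funext fun t => h.eq_add 0 t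
  filter_upwards [LocallyIntegrable.ae_hasDerivAt_integral h.1] with t ht
  rw [h1]
  exact (ht 0).const_add _

theorem absolutelyContinuousOnInterval (h : IsPrimitive F f) (a b : ℝ) :
    AbsolutelyContinuousOnInterval F a b := by
  -- The increments of `F` are dominated by those of the scalar primitive of `‖f‖`, for which
  -- absolute continuity is known.
  have hn : LocallyIntegrable fun s => ‖f s‖ := fun x =>
    let ⟨u, hu, hi⟩ := h.1 x; ⟨u, hu, hi.norm⟩
  have key := (hn.intervalIntegrable a b).absolutelyContinuousOnInterval_intervalIntegral
    (c := a) left_mem_uIcc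
  refine squeeze_zero (fun _ => Finset.sum_nonneg fun _ _ => dist_nonneg) (fun I => ?_) key
  refine Finset.sum_le_sum fun i _ => ?_
  rw [dist_comm, dist_eq_norm, h.sub_eq, dist_comm, Real.dist_eq,
    intervalIntegral.integral_interval_sub_left (hn.intervalIntegrable _ _)
      (hn.intervalIntegrable _ _)]
  exact intervalIntegral.norm_integral_le_abs_integral_norm

theorem add (h : IsPrimitive F f) (h' : IsPrimitive G g) :
    IsPrimitive (fun t => F t + G t) fun t => f t + g t where
  locallyIntegrable := h.1.add h'.1
  sub_eq a b := by
    rw [intervalIntegral.integral_add (h.1.intervalIntegrable a b)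
      (h'.1.intervalIntegrable a b), ← h.sub_eq, ← h'.sub_eq]
    abel

theorem const_mul {F f : ℝ → ℂ} (h : IsPrimitive F f) (c : ℂ) :
    IsPrimitive (fun t => c * F t) fun t => c * f t where
  locallyIntegrable := h.1.smul c
  sub_eq a b := by rw [intervalIntegral.integral_const_mul, ← h.sub_eq]; ring

theorem const (c : E) : IsPrimitive (fun _ => c) fun _ => 0 where
  locallyIntegrable := locallyIntegrable_zero
  sub_eq a b := by simp

theorem sum {ι : Type*} (s : Finset ι) {F f : ι → ℝ → E} (h : ∀ i ∈ s, IsPrimitive (F i) (f i)) :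
    IsPrimitive (fun t => ∑ i ∈ s, F i t) fun t => ∑ i ∈ s, f i t := by
  classical
  induction s using Finset.induction_on with
  | empty => simpa using const (0 : E)
  | insert i s hi ih =>
    simp only [Finset.sum_insert hi]
    exact (h i (by simp)).add (ih fun j hj => h j (by simp [hj]))

theorem congr (h : IsPrimitive F f) (hF : ∀ t, F t = G t) (hf : ∀ t, f t = g t) :
    IsPrimitive G g := by
  rwa [← funext hF, ← funext hf]

/-- Product rule with an exponential factor. -/
theorem exp_mul {F f : ℝ → ℂ} (h : IsPrimitive F f) (γ : ℂ) (τ : ℝ) :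
    IsPrimitive (fun t => Complex.exp (γ * ((t : ℂ) - τ)) * F t)
      fun t => γ * (Complex.exp (γ * ((t : ℂ) - τ)) * F t) +
        Complex.exp (γ * ((t : ℂ) - τ)) * f t := by
  have hF := h.continuous
  have hd : ∀ t : ℝ, HasDerivAt (fun t : ℝ => Complex.exp (γ * ((t : ℂ) - τ)))
      (γ * Complex.exp (γ * ((t : ℂ) - τ))) t := fun t => by
    have h1 : HasDerivAt (fun t : ℝ => γ * ((t : ℂ) - τ)) γ t := by
      simpa using (((hasDerivAt_id t).ofReal_comp.sub_const (τ : ℂ)).const_mul γ)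
    simpa [mul_comm] using h1.cexp
  have hc : Continuous fun t : ℝ => Complex.exp (γ * ((t : ℂ) - τ)) := by fun_prop
  have hloc : LocallyIntegrable fun t : ℝ => γ * (Complex.exp (γ * ((t : ℂ) - τ)) * F t) +
      Complex.exp (γ * ((t : ℂ) - τ)) * f t := by
    refine (Continuous.locallyIntegrable (by fun_prop)).add ?_
    rw [← locallyIntegrableOn_univ]
    exact (locallyIntegrableOn_univ.mpr h.1).continuousOn_mul hc.continuousOn
      isOpen_univ.isLocallyClosed
  refine ⟨hloc, fun a b => ?_⟩
  set g : ℝ → ℂ := fun t : ℝ => γ * (Complex.exp (γ * ((t : ℂ) - τ)) * F t) +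
      Complex.exp (γ * ((t : ℂ) - τ)) * f t with hg
  have hG : IsPrimitive (fun t => ∫ s in a..t, g s) g :=
    ⟨hloc, fun x y => intervalIntegral.integral_interval_sub_left
      (hloc.intervalIntegrable _ _) (hloc.intervalIntegrable _ _)⟩
  have hE : ContDiff ℝ 1 (fun t : ℝ => Complex.exp (γ * ((t : ℂ) - τ))) := by
    have : ContDiff ℝ 1 (fun t : ℝ => (t : ℂ)) := Complex.ofRealCLM.contDiff
    fun_prop
  -- The product minus the candidate primitive is absolutely continuous with derivative zero almost
  -- everywhere, hence constant.
  have hac := ((hE.contDiffOn (s := uIcc a b)).absolutelyContinuousOnInterval.smul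
    (h.absolutelyContinuousOnInterval a b)).sub (hG.absolutelyContinuousOnInterval a b)
  obtain ⟨C, hC⟩ := hac.const_of_ae_hasDerivAt_zero (by
    filter_upwards [h.ae_hasDerivAt, hG.ae_hasDerivAt] with t h1 h2 _
    convert! ((hd t).mul h1).sub h2 using 1
    simp only [hg]; ring)
  have h1 := hC a left_mem_uIcc
  have h2 := hC b right_mem_uIcc
  simp only [Pi.sub_apply, Pi.mul_apply, smul_eq_mul, intervalIntegral.integral_same] at h1 h2
  linear_combination h2 - h1

end IsPrimitive

/-- On `[t₀,∞)` the function `F` coincides with a primitive of the continuous `f`, so the jump of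
the indicator at `t₀` does not affect the one-sided derivative there. -/
theorem IsPrimitive.hasDerivWithinAt_Ici {E : Type*} [NormedAddCommGroup E] [NormedSpace ℝ E]
    [CompleteSpace E] {F f : ℝ → E} {t₀ : ℝ} (h : IsPrimitive F ((Ioi t₀).indicator f))
    (hf : Continuous f) {t : ℝ} (ht : t ∈ Ici t₀) : HasDerivWithinAt F (f t) (Ici t₀) t := by
  have hd : HasDerivAt (fun t => F t₀ + ∫ s in t₀..t, f s) (f t) t :=
    (intervalIntegral.integral_hasDerivAt_right (hf.intervalIntegrable t₀ t)
      (hf.stronglyMeasurableAtFilter _ _) hf.continuousAt).const_add _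
  have heq : ∀ x ∈ Ici t₀, F x = F t₀ + ∫ s in t₀..x, f s := fun x hx => by
    rw [h.eq_add t₀ x]
    congr 1
    refine intervalIntegral.integral_congr_ae (Eventually.of_forall fun s hs => ?_)
    rw [uIoc_of_le hx] at hs
    exact indicator_of_mem hs.1 f
  exact hd.hasDerivWithinAt.congr heq (heq t ht)

/-- Freezing an indefinite integral to the left of `T`. -/
theorem IsPrimitive.comp_max {E : Type*} [NormedAddCommGroup E] [NormedSpace ℝ E]
    {F f : ℝ → E} (h : IsPrimitive F f) (T : ℝ) :
    IsPrimitive (fun t => F (max t T)) ((Ioi T).indicator f) := by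
  have hl : LocallyIntegrable ((Ioi T).indicator f) := h.1.indicator measurableSet_Ioi
  have key : ∀ b, F (max b T) - F T = ∫ s in T..b, (Ioi T).indicator f s := fun b => by
    rcases le_total T b with hb | hb
    · rw [max_eq_left hb, h.sub_eq]
      refine intervalIntegral.integral_congr_ae (Eventually.of_forall fun s hs => ?_)
      rw [uIoc_of_le hb] at hs
      exact (indicator_of_mem hs.1 f).symm
    · rw [max_eq_right hb, sub_self,
        intervalIntegral.integral_zero_ae (Eventually.of_forall fun s hs => ?_)]
      rw [uIoc_of_ge hb] at hs
      exact indicator_of_notMem (not_lt.mpr hs.2) f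
  refine ⟨hl, fun a b => ?_⟩
  rw [← intervalIntegral.integral_interval_sub_left (hl.intervalIntegrable T b)
    (hl.intervalIntegrable T a), ← key, ← key]
  abel

/-- A solution of the first-order companion system gives a solution of the scalar equation. -/
theorem isSolution_of_isPrimitive {m : ℕ} (a : Fin (m + 1) → ℂ) (r : Fin (m + 1) → ℝ → ℂ)
    (t₀ : ℝ) (Y : ℕ → ℝ → ℂ)
    (hY : ∀ i < m, IsPrimitive (Y i) ((Ioi t₀).indicator (Y (i + 1))))
    (hm : IsPrimitive (Y m) ((Ioi t₀).indicator fun t =>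
      -∑ i : Fin (m + 1), (a i + r i t) * Y i t)) :
    IsSolution a r t₀ (Y 0) ∧
      ∀ i ≤ m, ∀ t ∈ Ici t₀, iteratedDerivWithin i (Y 0) (Ici t₀) t = Y i t := by
  have hcont : ∀ i ≤ m, Continuous (Y i) := fun i hi => by
    rcases hi.lt_or_eq with h | rfl
    exacts [(hY i h).continuous, hm.continuous]
  have hder : ∀ i < m, ∀ t ∈ Ici t₀, HasDerivWithinAt (Y i) (Y (i + 1) t) (Ici t₀) t :=
    fun i hi t ht => (hY i hi).hasDerivWithinAt_Ici (hcont _ hi) ht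
  have hud := uniqueDiffOn_Ici t₀
  have hit : ∀ i ≤ m, ∀ t ∈ Ici t₀, iteratedDerivWithin i (Y 0) (Ici t₀) t = Y i t := by
    intro i
    induction i with
    | zero => intro _ t _; simp
    | succ i ih =>
      intro hi t ht
      rw [iteratedDerivWithin_succ,
        derivWithin_congr (ih (by omega)) (ih (by omega) t ht)]
      exact (hder i hi t ht).derivWithin (hud t ht)
  refine ⟨⟨?_, fun T hT => ?_, ?_⟩, hit⟩
  · rw [contDiffOn_nat_iff_continuousOn_differentiableOn_deriv hud]
    refine ⟨fun i hi => (hcont i hi).continuousOn.congr (hit i hi), fun i hi => ?_⟩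
    exact DifferentiableOn.congr (fun t ht => (hder i hi t ht).differentiableWithinAt)
      (hit i (Nat.le_of_lt hi))
  · have h := hm.absolutelyContinuousOnInterval t₀ T
    refine Tendsto.congr' ?_ h
    rw [EventuallyEq, eventually_inf_principal]
    refine Eventually.of_forall fun I hI => Finset.sum_congr rfl fun i hi => ?_
    have h1 := hI.1 i hi
    rw [uIcc_of_le hT] at h1
    exact congrArg₂ dist (hit m le_rfl _ h1.1.1).symm (hit m le_rfl _ h1.2.1).symm
  · rw [ae_restrict_iff' measurableSet_Ici]
    -- The point `t₀` is discarded as a null set: the indicator vanishes there.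
    filter_upwards [hm.ae_hasDerivAt, Measure.ae_ne volume t₀] with t ht hne hmem
    rw [iteratedDerivWithin_succ, derivWithin_congr (hit m le_rfl) (hit m le_rfl t hmem),
      ht.hasDerivWithinAt.derivWithin (hud t hmem),
      indicator_of_mem (show t ∈ Ioi t₀ from lt_of_le_of_ne hmem (Ne.symm hne)), neg_add_eq_zero]
    refine Finset.sum_congr rfl fun i _ => ?_
    rw [hit i (Nat.lt_succ_iff.mp i.2) t hmem]

/-! ### Fixed points for pointwise weights -/

/-- A map contracting with respect to a pointwise weight `w`, which may vanish, has a fixed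
point. -/
theorem exists_fixedPoint_of_weighted {α E : Type*} [NormedAddCommGroup E] [CompleteSpace E]
    (w : α → ℝ≥0) (S : Set (α → E)) (Φ : (α → E) → α → E) (θ b : ℝ≥0) (hθ : θ < 1)
    (hΦ : MapsTo Φ S S)
    (hc : ∀ f ∈ S, ∀ g ∈ S, ∀ c : ℝ≥0, (∀ x, ‖f x - g x‖₊ ≤ c * w x) →
      ∀ x, ‖Φ f x - Φ g x‖₊ ≤ θ * c * w x)
    (f₀ : α → E) (hf₀ : f₀ ∈ S) (hb : ∀ x, ‖Φ f₀ x - f₀ x‖₊ ≤ b * w x)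
    (hS : ∀ (F : ℕ → α → E) (f : α → E), (∀ k, F k ∈ S) →
      (∀ x, Tendsto (fun k => F k x) atTop (𝓝 (f x))) →
      (∃ c : ℝ≥0, ∀ x, ‖f x - F 0 x‖₊ ≤ c * w x) → f ∈ S) :
    ∃ f ∈ S, (∀ x, Φ f x = f x) ∧ ∃ c : ℝ≥0, ∀ x, ‖f x - f₀ x‖₊ ≤ c * w x := by
  set F : ℕ → α → E := fun k => Φ^[k] f₀ with hF
  have hF' : ∀ k, F (k + 1) = Φ (F k) := fun k => Function.iterate_succ_apply' Φ k f₀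
  have hFS : ∀ k, F k ∈ S := fun k => by
    induction k with
    | zero => exact hf₀
    | succ k ih => rw [hF']; exact hΦ ih
  have hstep : ∀ k x, ‖F (k + 1) x - F k x‖₊ ≤ θ ^ k * b * w x := fun k => by
    induction k with
    | zero => intro x; simpa [hF] using hb x
    | succ k ih =>
      intro x
      have := hc _ (hFS (k + 1)) _ (hFS k) (θ ^ k * b) ih x
      rw [← hF', ← hF'] at this
      rwa [pow_succ', mul_assoc θ]
  have hθ' : (θ : ℝ) < 1 := by exact_mod_cast hθ
  have hgeo : ∀ x k, dist (F k x) (F (k + 1) x) ≤ (b * w x : ℝ) * (θ : ℝ) ^ k := fun x k => by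
    rw [dist_comm, dist_eq_norm]
    have := hstep k x
    rw [← NNReal.coe_le_coe] at this
    push_cast at this
    linarith [this]
  choose f hf using fun x => cauchySeq_tendsto_of_complete
    (cauchySeq_of_le_geometric (θ : ℝ) (b * w x : ℝ) hθ' (hgeo x))
  have hlim : ∀ k x, ‖f x - F k x‖₊ ≤ b * θ ^ k / (1 - θ) * w x := fun k x => by
    have h := dist_le_of_le_geometric_of_tendsto (θ : ℝ) (b * w x : ℝ) hθ' (hgeo x) (hf x) k
    rw [dist_comm, dist_eq_norm] at h
    rw [← NNReal.coe_le_coe]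
    push_cast [NNReal.coe_sub hθ.le]
    exact h.trans_eq (by ring)
  have hfS : f ∈ S := hS F f hFS hf ⟨_, hlim 0⟩
  refine ⟨f, hfS, fun x => ?_, ⟨_, hlim 0⟩⟩
  refine tendsto_nhds_unique ?_ ((tendsto_add_atTop_iff_nat 1).mpr (hf x))
  -- No continuity of `Φ` is assumed: contraction applied to the pair `f`, `F k`, whose weighted
  -- distance is geometric in `k`, gives `Φ (F k) → Φ f` pointwise.
  have hz : Tendsto (fun k : ℕ => θ * (b * θ ^ k / (1 - θ)) * w x) atTop (𝓝 0) := by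
    have := ((NNReal.tendsto_pow_atTop_nhds_zero_of_lt_one hθ).const_mul
      (θ * b / (1 - θ) * w x))
    rw [mul_zero] at this
    exact this.congr fun k => by rw [div_eq_mul_inv, div_eq_mul_inv]; ring
  rw [tendsto_iff_norm_sub_tendsto_zero]
  refine squeeze_zero (fun _ => norm_nonneg _) (fun k => ?_) (NNReal.tendsto_coe.mpr hz)
  rw [hF', norm_sub_rev]
  exact_mod_cast hc _ hfS _ (hFS k) _ (hlim k) x

/-! ### Green kernels and exponential averages -/

theorem norm_greenKernel {ω : ℂ} (hω : ω.re ≠ 0) (t s : ℝ) :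
    ‖greenKernel ω t s‖ =
      if Real.sign ω.re * (t - s) < 0 then Real.exp (-(|ω.re| * |t - s|)) else 0 := by
  unfold greenKernel
  split_ifs with h
  · rw [norm_mul, Complex.norm_exp]
    have h1 : ‖-((Real.sign ω.re : ℝ) : ℂ)‖ = 1 := by
      rw [norm_neg, Complex.norm_real]
      rcases Real.sign_apply_eq_of_ne_zero _ hω with h | h <;> simp [h]
    rw [h1, one_mul]
    congr 1
    rw [← abs_mul]
    have h2 : ω.re * (t - s) < 0 := by
      rcases lt_or_gt_of_ne hω with h0 | h0
      · rw [Real.sign_of_neg h0] at h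
        nlinarith
      · rw [Real.sign_of_pos h0] at h
        nlinarith
    rw [abs_of_neg h2]
    simp [Complex.mul_re]
  · simp

theorem measurable_greenKernel (ω : ℂ) : Measurable fun p : ℝ × ℝ => greenKernel ω p.1 p.2 := by
  unfold greenKernel
  refine Measurable.ite (measurableSet_lt (by fun_prop) (by fun_prop)) ?_ (by fun_prop)
  have : Continuous fun p : ℝ × ℝ => -(Real.sign ω.re : ℂ) *
    Complex.exp (ω * ((p.1 : ℂ) - (p.2 : ℂ))) := by fun_prop
  exact this.measurable

/-- The exponential kernel `e^{-β|t-s|}`. -/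
noncomputable def expKernel (β t s : ℝ) : ℝ≥0∞ := ENNReal.ofReal (Real.exp (-(β * |t - s|)))

/-- The exponential average `∫ e^{-β|t-s|} |q(s)| ds`. -/
noncomputable def expAvg (β : ℝ) (q : ℝ → ℂ) (t : ℝ) : ℝ≥0∞ := ∫⁻ s, expKernel β t s * ‖q s‖ₑ

theorem measurable_expKernel (β : ℝ) : Measurable fun p : ℝ × ℝ => expKernel β p.1 p.2 := by
  unfold expKernel
  have : Continuous fun p : ℝ × ℝ => Real.exp (-(β * |p.1 - p.2|)) := by fun_prop
  exact this.measurable.ennreal_ofReal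

theorem enorm_greenKernel_le {ω : ℂ} (hω : ω.re ≠ 0) {β : ℝ} (hβ : β ≤ |ω.re|) (t s : ℝ) :
    ‖greenKernel ω t s‖ₑ ≤ expKernel β t s := by
  rw [← ofReal_norm, norm_greenKernel hω]
  refine ENNReal.ofReal_le_ofReal ?_
  split_ifs
  · exact Real.exp_le_exp.mpr (neg_le_neg (mul_le_mul_of_nonneg_right hβ (abs_nonneg _)))
  · exact (Real.exp_pos _).le

theorem shift_re_ne_zero_and_sign {α β : ℝ} (hβ : 0 < β) (hα : β < |α|) :
    Real.sign (α - Real.sign α * β) = Real.sign α ∧ |α - Real.sign α * β| = |α| - β ∧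
      α - Real.sign α * β ≠ 0 ∧ α ≠ 0 := by
  rcases lt_trichotomy α 0 with h | h | h
  · rw [abs_of_neg h] at hα
    rw [Real.sign_of_neg h, Real.sign_of_neg (by linarith), abs_of_neg (by linarith),
      abs_of_neg h]
    exact ⟨rfl, by ring, by linarith, h.ne⟩
  · simp [h] at hα; linarith
  · rw [abs_of_pos h] at hα
    rw [Real.sign_of_pos h, Real.sign_of_pos (by linarith), abs_of_pos (by linarith),
      abs_of_pos h]
    exact ⟨rfl, by ring, by linarith, h.ne'⟩

/-- From `|t-τ| ≤ |t-s| + |s-τ|`: the factor `e^{-|α||t-s|}` gives up `e^{-β|t-s|}` to replace `s`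
by `t` in the second kernel. The shifted exponent keeps its sign, so both Green kernels live on the
same half-line. This is where the exponents in (2) come from. -/
theorem enorm_greenKernel_mul_expKernel_le {γ : ℂ} {β : ℝ} (hβ : 0 < β) (hγ : β < |γ.re|)
    (t s τ : ℝ) :
    ‖greenKernel γ t s‖ₑ * expKernel β s τ ≤
      ‖greenKernel ((γ.re - Real.sign γ.re * β : ℝ) : ℂ) t s‖ₑ * expKernel β t τ := by
  obtain ⟨h1, h2, h3, h4⟩ := shift_re_ne_zero_and_sign hβ hγ
  rw [← ofReal_norm, ← ofReal_norm, norm_greenKernel h4,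
    norm_greenKernel (by simpa using h3)]
  simp only [Complex.ofReal_re]
  rw [h1, h2, expKernel, expKernel, ← ENNReal.ofReal_mul (by positivity),
    ← ENNReal.ofReal_mul (by positivity)]
  refine ENNReal.ofReal_le_ofReal ?_
  split_ifs
  · rw [← Real.exp_add, ← Real.exp_add]
    refine Real.exp_le_exp.mpr ?_
    nlinarith [abs_sub_le t s τ]
  · simp

theorem enorm_greenKernel_mul_expAvg_le {γ : ℂ} {β : ℝ} (hβ : 0 < β) (hγ : β < |γ.re|)
    {q : ℝ → ℂ} (hq : AEStronglyMeasurable q) (t s : ℝ) :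
    ‖greenKernel γ t s‖ₑ * expAvg β q s ≤
      ‖greenKernel ((γ.re - Real.sign γ.re * β : ℝ) : ℂ) t s‖ₑ * expAvg β q t := by
  have hm : ∀ t, AEMeasurable fun τ => expKernel β t τ * ‖q τ‖ₑ := fun t =>
    ((measurable_expKernel β).comp (measurable_prodMk_left (x := t))).aemeasurable.mul hq.enorm
  rw [expAvg, expAvg, ← lintegral_const_mul'' _ (hm s), ← lintegral_const_mul'' _ (hm t)]
  refine lintegral_mono fun τ => ?_
  rw [← mul_assoc, ← mul_assoc]
  exact mul_le_mul_left (enorm_greenKernel_mul_expKernel_le hβ hγ t s τ) _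

/-- The Green operator produces a solution of `x' = γ x + h`. -/
theorem isPrimitive_greenKernel {γ : ℂ} (hγ : γ.re ≠ 0) {h : ℝ → ℂ} (hh : LocallyIntegrable h)
    (hi : ∀ t, Integrable fun s => greenKernel γ t s * h s) :
    IsPrimitive (fun t => ∫ s, greenKernel γ t s * h s)
      fun t => γ * (∫ s, greenKernel γ t s * h s) + h t := by
  -- Integrating factor: the Green integral is `e^{γt}` times a primitive of `k`, taken from `-∞`
  -- when `Re γ < 0` and from `+∞` when `Re γ > 0`.
  set k : ℝ → ℂ := fun s => Complex.exp (-γ * s) * h s with hk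
  have hkl : LocallyIntegrable k := by
    have hc : Continuous fun s : ℝ => Complex.exp (-γ * s) := by fun_prop
    rw [← locallyIntegrableOn_univ]
    exact (locallyIntegrableOn_univ.mpr hh).continuousOn_mul hc.continuousOn
      isOpen_univ.isLocallyClosed
  have hexp : ∀ t s : ℝ, Complex.exp (γ * ((t : ℂ) - s)) * h s =
      Complex.exp (γ * ((t : ℂ) - (0 : ℝ))) * k s := fun t s => by
    simp only [hk]
    rw [← mul_assoc, ← Complex.exp_add]
    congr 2; push_cast; ring
  have hback : ∀ t s : ℝ, k s = Complex.exp (-(γ * (t : ℂ))) *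
      (Complex.exp (γ * ((t : ℂ) - s)) * h s) := fun t s => by
    simp only [hk]
    rw [← mul_assoc, ← Complex.exp_add]
    congr 2; ring
  have hfin : ∀ (H : ℝ → ℂ), IsPrimitive H k →
      (∀ t, ∫ s, greenKernel γ t s * h s = Complex.exp (γ * ((t : ℂ) - (0 : ℝ))) * H t) →
      IsPrimitive (fun t => ∫ s, greenKernel γ t s * h s)
        fun t => γ * (∫ s, greenKernel γ t s * h s) + h t := fun H hH hG => by
    refine (hH.exp_mul γ 0).congr (fun t => (hG t).symm) fun t => ?_
    rw [hG t, ← hexp t t]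
    simp
  rcases lt_or_gt_of_ne hγ with h0 | h0
  · have hker : ∀ t, (fun s => greenKernel γ t s * h s) =
        (Iio t).indicator fun s => Complex.exp (γ * ((t : ℂ) - s)) * h s := fun t => by
      funext s
      by_cases hs : s < t
      · rw [indicator_of_mem (show s ∈ Iio t from hs), greenKernel, Real.sign_of_neg h0,
          if_pos (by linarith)]
        simp
      · rw [indicator_of_notMem (show s ∉ Iio t from hs), greenKernel, Real.sign_of_neg h0,
          if_neg (by linarith), zero_mul]
    have hki : ∀ t, IntegrableOn k (Iic t) := fun t => by
      rw [integrableOn_Iic_iff_integrableOn_Iio]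
      have := hi t
      rw [hker, integrable_indicator_iff measurableSet_Iio] at this
      exact (this.const_mul (Complex.exp (-(γ * (t : ℂ))))).congr
        (Eventually.of_forall fun s => (hback t s).symm)
    refine hfin (fun t => ∫ s in Iic t, k s) ⟨hkl, fun a b =>
      intervalIntegral.integral_Iic_sub_Iic (hki a) (hki b)⟩ fun t => ?_
    rw [hker, integral_indicator measurableSet_Iio, ← integral_Iic_eq_integral_Iio,
      ← integral_const_mul]
    exact integral_congr_ae (Eventually.of_forall fun s => hexp t s)
  · have hker : ∀ t, (fun s => greenKernel γ t s * h s) =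
        (Ioi t).indicator fun s => -(Complex.exp (γ * ((t : ℂ) - s)) * h s) := fun t => by
      funext s
      by_cases hs : t < s
      · rw [indicator_of_mem (show s ∈ Ioi t from hs), greenKernel, Real.sign_of_pos h0,
          if_pos (by linarith)]
        simp
      · rw [indicator_of_notMem (show s ∉ Ioi t from hs), greenKernel, Real.sign_of_pos h0,
          if_neg (by linarith), zero_mul]
    have hki : ∀ t, IntegrableOn k (Ioi t) := fun t => by
      have := hi t
      rw [hker, integrable_indicator_iff measurableSet_Ioi] at this
      exact (this.neg.const_mul (Complex.exp (-(γ * (t : ℂ))))).congr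
        (Eventually.of_forall fun s => by simp [← hback t s])
    refine hfin (fun t => -∫ s in Ioi t, k s) ⟨hkl, fun a b => ?_⟩ fun t => ?_
    · rw [← intervalIntegral.integral_Ioi_sub_Ioi' (hki a) (hki b)]
      ring
    · rw [hker, integral_indicator measurableSet_Ioi, integral_neg, mul_neg,
        ← integral_const_mul]
      exact congrArg _ (integral_congr_ae (Eventually.of_forall fun s => hexp t s))

theorem integrable_exp_neg_mul_abs {β : ℝ} (hβ : 0 < β) :
    Integrable fun t : ℝ => Real.exp (-(β * |t|)) := by
  rw [← integrableOn_univ, ← Iic_union_Ioi (a := (0 : ℝ))]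
  refine IntegrableOn.union ?_ ?_
  · refine (integrableOn_exp_mul_Iic hβ 0).congr_fun (fun t ht => ?_) measurableSet_Iic
    simp only [abs_of_nonpos (show t ≤ 0 from ht)]
    congr 1; ring
  · refine (integrableOn_exp_mul_Ioi (neg_neg_of_pos hβ) 0).congr_fun (fun t ht => ?_)
      measurableSet_Ioi
    simp only [abs_of_pos (show 0 < t from ht)]
    congr 1; ring

/-- Tonelli and translation invariance; the constant is the integral of `e^{-β|t|}`. -/
theorem exists_lintegral_expAvg_le {β : ℝ} (hβ : 0 < β) :
    ∃ C : ℝ≥0, ∀ q : ℝ → ℂ, AEStronglyMeasurable q →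
      ∫⁻ t, expAvg β q t ≤ C * ∫⁻ s, ‖q s‖ₑ := by
  have hfin : ∫⁻ t, expKernel β t 0 ≠ ∞ := by
    have := (integrable_exp_neg_mul_abs hβ).lintegral_lt_top
    simpa [expKernel] using this.ne
  refine ⟨(∫⁻ t, expKernel β t 0).toNNReal, fun q hq => ?_⟩
  rw [ENNReal.coe_toNNReal hfin]
  unfold expAvg
  rw [lintegral_lintegral_swap ((measurable_expKernel β).aemeasurable.mul
    hq.comp_snd.enorm), ← lintegral_const_mul'' _ hq.enorm]
  refine (lintegral_congr fun s => ?_).le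
  have hm : Measurable fun t => expKernel β t s :=
    (measurable_expKernel β).comp (measurable_prodMk_right (y := s))
  rw [lintegral_mul_const'' _ hm.aemeasurable]
  congr 1
  have := lintegral_sub_right_eq_self (μ := volume) (fun t => expKernel β t 0) s
  rw [← this]
  simp [expKernel]

theorem expKernel_le_one {β : ℝ} (hβ : 0 < β) (t s : ℝ) : expKernel β t s ≤ 1 := by
  rw [expKernel, ← ENNReal.ofReal_one]
  refine ENNReal.ofReal_le_ofReal (Real.exp_le_one_iff.mpr ?_)
  have := abs_nonneg (t - s)
  nlinarith

theorem expAvg_le_lintegral {β : ℝ} (hβ : 0 < β) (q : ℝ → ℂ) (t : ℝ) :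
    expAvg β q t ≤ ∫⁻ s, ‖q s‖ₑ :=
  lintegral_mono fun s => mul_le_of_le_one_left' (expKernel_le_one hβ t s)

theorem aemeasurable_expAvg (β : ℝ) {q : ℝ → ℂ} (hq : AEStronglyMeasurable q) :
    AEMeasurable (expAvg β q) := by
  refine AEMeasurable.lintegral_prod_right' (f := fun p : ℝ × ℝ => expKernel β p.1 p.2 * ‖q p.2‖ₑ)
    ((measurable_expKernel β).aemeasurable.mul hq.comp_snd.enorm)

theorem tendsto_expAvg {β : ℝ} (hβ : 0 < β) {q : ℝ → ℂ} (hq : Integrable q) :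
    Tendsto (expAvg β q) atTop (𝓝 0) := by
  have hm : ∀ t, AEMeasurable fun τ => expKernel β t τ * ‖q τ‖ₑ := fun t =>
    ((measurable_expKernel β).comp (measurable_prodMk_left (x := t))).aemeasurable.mul
      hq.aestronglyMeasurable.enorm
  have h := tendsto_lintegral_filter_of_dominated_convergence' (μ := volume)
    (l := (atTop : Filter ℝ)) (F := fun t s => expKernel β t s * ‖q s‖ₑ) (f := fun _ => 0)
    (fun s => ‖q s‖ₑ) (Eventually.of_forall hm)
    (Eventually.of_forall fun t => Eventually.of_forall fun s =>
      mul_le_of_le_one_left' (expKernel_le_one hβ t s)) hq.2.ne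
    (Eventually.of_forall fun s => by
      have h1 : Tendsto (fun t : ℝ => expKernel β t s) atTop (𝓝 0) := by
        rw [← ENNReal.ofReal_zero]
        refine ENNReal.tendsto_ofReal (Real.tendsto_exp_neg_atTop_nhds_zero.comp ?_)
        exact (tendsto_abs_atTop_atTop.comp
          (tendsto_atTop_add_const_right _ (-s) tendsto_id)).const_mul_atTop hβ
      simpa using ENNReal.Tendsto.mul_const h1 (Or.inr enorm_ne_top))
  rw [lintegral_zero] at h
  exact h

theorem greenInt_eq_lintegral_indicator (t₀ : ℝ) (ω : ℂ) (f : ℝ → ℂ) (t : ℝ) :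
    greenInt t₀ ω f t = ∫⁻ s, ‖greenKernel ω t s‖ₑ * ‖(Ici t₀).indicator f s‖ₑ := by
  rw [greenInt, ← lintegral_indicator measurableSet_Ici]
  refine lintegral_congr fun s => ?_
  by_cases hs : s ∈ Ici t₀ <;> simp [hs, enorm_mul]

/-- The kernels for `β` and `-β` are supported on `s > t` and `s < t`, and off the diagonal their
moduli add up to `e^{-β|t-s|}`. -/
theorem dichInt_eq_expAvg {β : ℝ} (hβ : 0 < β) {t₀ : ℝ} {f : ℝ → ℂ}
    (hf : AEStronglyMeasurable ((Ici t₀).indicator f)) (t : ℝ) :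
    dichInt t₀ β f t = expAvg β ((Ici t₀).indicator f) t := by
  have hm : AEMeasurable fun s => ‖greenKernel β t s‖ₑ * ‖(Ici t₀).indicator f s‖ₑ :=
    ((measurable_greenKernel _).comp
      (measurable_prodMk_left (x := t))).enorm.aemeasurable.mul hf.enorm
  rw [dichInt, greenInt_eq_lintegral_indicator, greenInt_eq_lintegral_indicator,
    ← lintegral_add_left' hm, expAvg]
  refine lintegral_congr_ae ?_
  filter_upwards [Measure.ae_ne volume t] with s hs
  rw [← add_mul]
  congr 1
  rw [← ofReal_norm, ← ofReal_norm, norm_greenKernel (by simpa using hβ.ne'),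
    norm_greenKernel (by simpa using hβ.ne'), expKernel]
  simp only [Complex.neg_re, Complex.ofReal_re]
  rw [Real.sign_of_pos hβ, Real.sign_of_neg (neg_neg_of_pos hβ), abs_neg, abs_of_pos hβ]
  rcases lt_or_gt_of_ne hs with h | h
  · rw [if_neg (by linarith), if_pos (by linarith)]; simp
  · rw [if_pos (by linarith), if_neg (by linarith)]; simp

/-- The supremum in (2) runs over `t ≥ t₀` only, whereas the fixed point problem is posed on the
whole line; this transfers the bound to `t < t₀`. -/
theorem greenInt_le_of_le {t₀ : ℝ} {ω : ℂ} (hω : ω.re ≠ 0) (f : ℝ → ℂ) {t : ℝ} (ht : t ≤ t₀) :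
    greenInt t₀ ω f t ≤ greenInt t₀ ω f t₀ := by
  unfold greenInt
  -- The endpoint `s = t₀` must go: the kernel with `Re ω > 0` vanishes at `(t₀,t₀)` but not at
  -- `(t,t₀)` for `t < t₀`.
  rw [← setLIntegral_congr Ioi_ae_eq_Ici, ← setLIntegral_congr Ioi_ae_eq_Ici]
  refine setLIntegral_mono' measurableSet_Ioi fun s hs => ?_
  have hs' : t₀ < s := hs
  rw [enorm_mul, enorm_mul]
  refine mul_le_mul_left ?_ _
  rw [← ofReal_norm, ← ofReal_norm, norm_greenKernel hω, norm_greenKernel hω]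
  refine ENNReal.ofReal_le_ofReal ?_
  rcases lt_or_gt_of_ne hω with h0 | h0
  · rw [Real.sign_of_neg h0, if_neg (by linarith), if_neg (by linarith)]
  · rw [Real.sign_of_pos h0, if_pos (by linarith), if_pos (by linarith)]
    refine Real.exp_le_exp.mpr (neg_le_neg (mul_le_mul_of_nonneg_left ?_ (abs_nonneg _)))
    rw [abs_of_neg (by linarith), abs_of_neg (by linarith)]
    linarith

/-! ### Taylor expansion and partial fractions -/

theorem eval_add_eq_sum_iterate_derivative {p : ℂ[X]} {m : ℕ} (hp : p.natDegree ≤ m) (x y : ℂ) :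
    p.eval (y + x) =
      ∑ k ∈ Finset.range (m + 1), (Polynomial.derivative^[k] p).eval x / k.factorial * y ^ k := by
  rw [← Polynomial.taylor_eval, Polynomial.eval_eq_sum_range' (n := m + 1)
    (by rw [Polynomial.natDegree_taylor]; omega)]
  refine Finset.sum_congr rfl fun k _ => ?_
  rw [Polynomial.taylor_coeff, ← Polynomial.factorial_smul_hasseDeriv]
  have : (k.factorial : ℂ) ≠ 0 := by exact_mod_cast k.factorial_ne_zero
  rw [LinearMap.smul_apply, Polynomial.eval_smul, nsmul_eq_mul]
  field_simp

/-- Partial fractions: the divided differences at the nodes `γ j` recover the coefficient of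
order `m` of the Taylor expansion. -/
theorem sum_div_gammaProd {m : ℕ} (hm : 0 < m) {γ : Fin m → ℂ} (hγ : Function.Injective γ)
    (hγ0 : ∀ j, γ j ≠ 0) (lam : ℂ) {f : ℂ[X]} (hf : f.natDegree ≤ m) :
    ∑ j, (f.eval (γ j + lam) - f.eval lam) / γ j / gammaProd γ j =
      (Polynomial.taylor lam f).coeff m := by
  set p := Polynomial.taylor lam f with hp
  -- The quotient `(f(x+λ) - f(λ))/x` has degree below `m`, so Lagrange interpolation at the `m`
  -- nodes `γⱼ` recovers its coefficient of order `m-1`.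
  have hd : p.divX.degree < (Finset.univ : Finset (Fin m)).card := by
    rw [Finset.card_univ, Fintype.card_fin]
    by_cases h0 : p.divX = 0
    · rw [h0]; simp
    rw [Polynomial.degree_eq_natDegree h0]
    have h1 : p.divX.natDegree = p.natDegree - 1 := Polynomial.natDegree_divX_eq_natDegree_tsub_one
    have h2 : p.natDegree ≤ m := by rw [hp, Polynomial.natDegree_taylor]; exact hf
    exact_mod_cast (by omega : p.divX.natDegree < m)
  have h := Lagrange.coeff_eq_sum (s := Finset.univ) (v := γ) hγ.injOn hd
  rw [Finset.card_univ, Fintype.card_fin, Polynomial.coeff_divX, Nat.sub_add_cancel hm] at h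
  rw [h]
  refine Finset.sum_congr rfl fun j _ => ?_
  rw [gammaProd]
  congr 1
  have h1 : p.eval (γ j) = f.eval (γ j + lam) := Polynomial.taylor_eval _ _ _
  have h2 : p.coeff 0 = f.eval lam := Polynomial.taylor_coeff_zero _ _
  have h3 : p.eval (γ j) = p.divX.eval (γ j) * γ j + p.coeff 0 := by
    conv_lhs => rw [← Polynomial.divX_mul_X_add p]
    simp
  rw [← h1, ← h2, h3, add_sub_cancel_right, mul_div_assoc, div_self (hγ0 j), mul_one]

/-! ### The integral operator in the weighted space -/

/-- Green kernels `g j`, coefficients `q`, `b k` and a weight `w` subject to the integral bounds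
that make the associated integral operator bounded with respect to `w`. -/
structure GreenData (m : ℕ) where
  g : Fin m → ℝ → ℝ → ℂ
  q : ℝ → ℂ
  b : Fin m → ℝ → ℂ
  w : ℝ → ℝ≥0
  M : Fin m → Fin m → ℝ≥0
  η : ℝ≥0
  measurable_g : ∀ j, Measurable fun p : ℝ × ℝ => g j p.1 p.2
  aesm_q : AEStronglyMeasurable q
  aesm_b : ∀ k, AEStronglyMeasurable (b k)
  aemeasurable_w : AEMeasurable w
  lintegral_q_le : ∀ j t, ∫⁻ s, ‖g j t s‖ₑ * ‖q s‖ₑ ≤ w t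
  lintegral_b_le : ∀ j k t, ∫⁻ s, ‖g j t s‖ₑ * (‖b k s‖ₑ * w s) ≤ M j k * w t
  lintegral_w_le : ∫⁻ t, w t ≤ η

namespace GreenData

variable {m : ℕ} (D : GreenData m)

/-- The right-hand side `-(q u + ∑ₖ bₖ Vₖ)` with `u(s) = 1 - ∫_s^∞ V₀`. -/
noncomputable def forcing [NeZero m] (V : ℝ → Fin m → ℂ) (s : ℝ) : ℂ :=
  -(D.q s * (1 - ∫ τ in Ioi s, V τ 0) + ∑ k, D.b k s * V s k)

theorem measurable_g_left (j : Fin m) (t : ℝ) : Measurable (D.g j t) :=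
  (D.measurable_g j).comp (measurable_prodMk_left (x := t))

/-- Serves both the self-map and the contraction estimate: `d = 1 + cη` for one forcing term, `d =
cη` for a difference of two. -/
theorem lintegral_enorm_mul_le {h : ℝ → ℂ} {d c : ℝ≥0}
    (hh : ∀ s, ‖h s‖ₑ ≤ d * ‖D.q s‖ₑ + ∑ k, c * (‖D.b k s‖ₑ * D.w s)) (j : Fin m) (t : ℝ) :
    ∫⁻ s, ‖D.g j t s * h s‖ₑ ≤ ((d + c * ∑ k, D.M j k) * D.w t : ℝ≥0) := by
  have hg : AEMeasurable fun s => ‖D.g j t s‖ₑ := (D.measurable_g_left j t).enorm.aemeasurable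
  have hq : AEMeasurable fun s => ‖D.g j t s‖ₑ * ‖D.q s‖ₑ := hg.mul D.aesm_q.enorm
  have hb : ∀ k, AEMeasurable fun s => ‖D.g j t s‖ₑ * (‖D.b k s‖ₑ * D.w s) := fun k =>
    hg.mul ((D.aesm_b k).enorm.mul D.aemeasurable_w.coe_nnreal_ennreal)
  calc ∫⁻ s, ‖D.g j t s * h s‖ₑ
      ≤ ∫⁻ s, (d * (‖D.g j t s‖ₑ * ‖D.q s‖ₑ) +
          ∑ k, c * (‖D.g j t s‖ₑ * (‖D.b k s‖ₑ * D.w s))) := by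
        refine lintegral_mono fun s => ?_
        rw [enorm_mul]
        refine (mul_le_mul_right (hh s) _).trans_eq ?_
        rw [mul_add, Finset.mul_sum]
        congr 1
        · ring
        · exact Finset.sum_congr rfl fun k _ => by ring
    _ = d * (∫⁻ s, ‖D.g j t s‖ₑ * ‖D.q s‖ₑ) +
          ∑ k, c * ∫⁻ s, ‖D.g j t s‖ₑ * (‖D.b k s‖ₑ * D.w s) := by
        rw [lintegral_add_left' (hq.const_mul _), lintegral_const_mul'' _ hq,
          lintegral_finsetSum' _ fun k _ => (hb k).const_mul _]
        congr 1
        exact Finset.sum_congr rfl fun k _ => lintegral_const_mul'' _ (hb k)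
    _ ≤ d * D.w t + ∑ k, (c : ℝ≥0∞) * (D.M j k * D.w t) := by
        exact add_le_add (mul_le_mul_right (D.lintegral_q_le j t) _)
          (Finset.sum_le_sum fun k _ => mul_le_mul_right (D.lintegral_b_le j k t) _)
    _ = ((d + c * ∑ k, D.M j k) * D.w t : ℝ≥0) := by
        push_cast
        rw [add_mul, mul_assoc, Finset.sum_mul, Finset.mul_sum]

theorem nnnorm_integral_mul_le {h : ℝ → ℂ} {d c : ℝ≥0}
    (hh : ∀ s, ‖h s‖ₑ ≤ d * ‖D.q s‖ₑ + ∑ k, c * (‖D.b k s‖ₑ * D.w s)) (j : Fin m) (t : ℝ) :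
    ‖∫ s, D.g j t s * h s‖₊ ≤ (d + c * ∑ k, D.M j k) * D.w t := by
  have := (enorm_integral_le_lintegral_enorm _).trans (D.lintegral_enorm_mul_le hh j t)
  rw [enorm_eq_nnnorm] at this
  exact_mod_cast this

theorem integrable_mul {h : ℝ → ℂ} (hm : AEStronglyMeasurable h) {d c : ℝ≥0}
    (hh : ∀ s, ‖h s‖ₑ ≤ d * ‖D.q s‖ₑ + ∑ k, c * (‖D.b k s‖ₑ * D.w s)) (j : Fin m) (t : ℝ) :
    Integrable fun s => D.g j t s * h s :=
  ⟨(D.measurable_g_left j t).aestronglyMeasurable.mul hm,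
    (D.lintegral_enorm_mul_le hh j t).trans_lt ENNReal.coe_lt_top⟩

theorem integrable_of_le {V : ℝ → Fin m → ℂ} (hV : AEStronglyMeasurable V) {c : ℝ≥0}
    (hc : ∀ t, ‖V t‖₊ ≤ c * D.w t) (i : Fin m) : Integrable fun t => V t i := by
  refine ⟨(continuous_apply i).comp_aestronglyMeasurable hV, ?_⟩
  have h1 : ∫⁻ t, ‖V t i‖ₑ ≤ c * D.η := by
    refine le_trans (lintegral_mono (g := fun t => (c : ℝ≥0∞) * D.w t) fun t => ?_) ?_
    · change (‖V t i‖₊ : ℝ≥0∞) ≤ c * D.w t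
      exact_mod_cast (nnnorm_le_pi_nnnorm (V t) i).trans (hc t)
    · rw [lintegral_const_mul'' _ D.aemeasurable_w.coe_nnreal_ennreal]
      gcongr
      exact D.lintegral_w_le
  exact h1.trans_lt (by exact_mod_cast ENNReal.coe_lt_top (r := c * D.η))

theorem nnnorm_setIntegral_le {V : ℝ → Fin m → ℂ} {c : ℝ≥0}
    (hc : ∀ t, ‖V t‖₊ ≤ c * D.w t) (i : Fin m) (s : ℝ) : ‖∫ τ in Ioi s, V τ i‖₊ ≤ c * D.η := by
  have h1 : ‖∫ τ in Ioi s, V τ i‖ₑ ≤ c * D.η := by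
    refine (enorm_integral_le_lintegral_enorm _).trans ((setLIntegral_le_lintegral _ _).trans ?_)
    refine le_trans (lintegral_mono (g := fun t => (c : ℝ≥0∞) * D.w t) fun t => ?_) ?_
    · change (‖V t i‖₊ : ℝ≥0∞) ≤ c * D.w t
      exact_mod_cast (nnnorm_le_pi_nnnorm (V t) i).trans (hc t)
    · rw [lintegral_const_mul'' _ D.aemeasurable_w.coe_nnreal_ennreal]
      gcongr
      exact D.lintegral_w_le
  rw [enorm_eq_nnnorm] at h1
  exact_mod_cast h1

theorem enorm_sum_mul_le {v : Fin m → ℂ} {c : ℝ≥0} {s : ℝ} (hv : ‖v‖₊ ≤ c * D.w s) :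
    ‖∑ k, D.b k s * v k‖ₑ ≤ ∑ k, c * (‖D.b k s‖ₑ * D.w s) := by
  refine (enorm_sum_le _ _).trans (Finset.sum_le_sum fun k _ => ?_)
  rw [enorm_mul, mul_left_comm]
  refine mul_le_mul_right ?_ _
  rw [enorm_eq_nnnorm]
  exact_mod_cast (nnnorm_le_pi_nnnorm v k).trans hv

variable [NeZero m]

theorem aestronglyMeasurable_forcing {V : ℝ → Fin m → ℂ} (hV : AEStronglyMeasurable V) :
    AEStronglyMeasurable (D.forcing V) := by
  have hVi : ∀ i, AEStronglyMeasurable fun t => V t i := fun i =>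
    (continuous_apply i).comp_aestronglyMeasurable hV
  have h1 : AEStronglyMeasurable fun s => ∫ τ in Ioi s, V τ 0 := by
    -- The tail integral is a parametric integral over the half-plane `s < τ`, so Fubini
    -- measurability applies.
    have h2 : MeasurableSet {p : ℝ × ℝ | p.1 < p.2} :=
      measurableSet_lt measurable_fst measurable_snd
    have h3 := (((hVi 0).comp_snd (μ := volume)).indicator h2).integral_prod_right'
    refine h3.congr (Eventually.of_forall fun s => ?_)
    simp only
    rw [← integral_indicator measurableSet_Ioi]
    rfl
  refine ((D.aesm_q.mul (aestronglyMeasurable_const.sub h1)).add ?_).neg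
  exact Finset.aestronglyMeasurable_fun_sum _ fun k _ => (D.aesm_b k).mul (hVi k)

theorem enorm_forcing_le {V : ℝ → Fin m → ℂ} {c : ℝ≥0} (hc : ∀ t, ‖V t‖₊ ≤ c * D.w t) (s : ℝ) :
    ‖D.forcing V s‖ₑ ≤ (1 + c * D.η : ℝ≥0) * ‖D.q s‖ₑ + ∑ k, c * (‖D.b k s‖ₑ * D.w s) := by
  rw [forcing, enorm_neg]
  refine (enorm_add_le _ _).trans (add_le_add ?_ (D.enorm_sum_mul_le (hc s)))
  rw [enorm_mul, mul_comm]
  refine mul_le_mul_left ?_ _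
  rw [enorm_eq_nnnorm]
  have h := (nnnorm_sub_le (1 : ℂ) (∫ τ in Ioi s, V τ 0)).trans
    (add_le_add_right (D.nnnorm_setIntegral_le hc 0 s) _)
  rw [nnnorm_one] at h
  exact_mod_cast h

/-- The constant `1` in `u` cancels, so the coefficient of `q` is proportional to the distance `c`.
-/
theorem enorm_forcing_sub_le {V W : ℝ → Fin m → ℂ} (hV : AEStronglyMeasurable V)
    (hW : AEStronglyMeasurable W) {cV cW c : ℝ≥0} (hcV : ∀ t, ‖V t‖₊ ≤ cV * D.w t)
    (hcW : ∀ t, ‖W t‖₊ ≤ cW * D.w t) (hc : ∀ t, ‖V t - W t‖₊ ≤ c * D.w t) (s : ℝ) :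
    ‖D.forcing V s - D.forcing W s‖ₑ ≤
      (c * D.η : ℝ≥0) * ‖D.q s‖ₑ + ∑ k, c * (‖D.b k s‖ₑ * D.w s) := by
  have h1 : D.forcing V s - D.forcing W s =
      D.q s * (∫ τ in Ioi s, (V τ - W τ) 0) + -∑ k, D.b k s * (V s - W s) k := by
    have h2 : ∫ τ in Ioi s, (V τ - W τ) 0 = (∫ τ in Ioi s, V τ 0) - ∫ τ in Ioi s, W τ 0 :=
      integral_sub (D.integrable_of_le hV hcV 0).integrableOn
        (D.integrable_of_le hW hcW 0).integrableOn
    have h3 : ∑ k, D.b k s * (V s - W s) k = ∑ k, D.b k s * V s k - ∑ k, D.b k s * W s k := by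
      rw [← Finset.sum_sub_distrib]
      exact Finset.sum_congr rfl fun k _ => by rw [Pi.sub_apply]; ring
    rw [forcing, forcing, h2, h3]
    ring
  rw [h1]
  refine (enorm_add_le _ _).trans (add_le_add ?_ ?_)
  · rw [enorm_mul, mul_comm]
    refine mul_le_mul_left ?_ _
    rw [enorm_eq_nnnorm]
    exact_mod_cast D.nnnorm_setIntegral_le hc 0 s
  · rw [enorm_neg]
    exact D.enorm_sum_mul_le (hc s)

/-- The terms in `b` contribute at most `1/2` and the tail integral in `u` at most `1/4`, so the
iteration from `V = 0` contracts by `3/4`. -/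
theorem exists_fixedPoint (A : Fin m → Fin m → ℂ)
    (hM : ∀ i, ∑ j, ‖A i j‖₊ * ∑ k, D.M j k ≤ 1 / 2) (hA : ∀ i, (∑ j, ‖A i j‖₊) * D.η ≤ 1 / 4) :
    ∃ V : ℝ → Fin m → ℂ, ∃ c : ℝ≥0, AEStronglyMeasurable V ∧ (∀ t, ‖V t‖₊ ≤ c * D.w t) ∧
      ∀ t i, V t i = ∑ j, A i j * ∫ s, D.g j t s * D.forcing V s := by
  set Φ : (ℝ → Fin m → ℂ) → ℝ → Fin m → ℂ := fun V t i =>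
    ∑ j, A i j * ∫ s, D.g j t s * D.forcing V s with hΦ
  set S : Set (ℝ → Fin m → ℂ) :=
    {V | AEStronglyMeasurable V ∧ ∃ c : ℝ≥0, ∀ t, ‖V t‖₊ ≤ c * D.w t} with hS
  have hbound : ∀ (h : Fin m → ℝ → ℂ) (d c : ℝ≥0) (t : ℝ) (v : Fin m → ℂ),
      (∀ j, ‖∫ s, D.g j t s * h j s‖₊ ≤ (d + c * ∑ k, D.M j k) * D.w t) →
      (∀ i, v i = ∑ j, A i j * ∫ s, D.g j t s * h j s) → ∀ i,
      ‖v i‖₊ ≤ ((∑ j, ‖A i j‖₊) * d + c * (∑ j, ‖A i j‖₊ * ∑ k, D.M j k)) * D.w t := by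
    intro h d c t v hh hv i
    rw [hv]
    refine (nnnorm_sum_le _ _).trans ?_
    calc ∑ j, ‖A i j * ∫ s, D.g j t s * h j s‖₊
        ≤ ∑ j, ‖A i j‖₊ * ((d + c * ∑ k, D.M j k) * D.w t) :=
          Finset.sum_le_sum fun j _ => by
            rw [nnnorm_mul]
            exact mul_le_mul_right (hh j) _
      _ = _ := by
          rw [add_mul, Finset.sum_mul, Finset.sum_mul, Finset.mul_sum, Finset.sum_mul,
            ← Finset.sum_add_distrib]
          exact Finset.sum_congr rfl fun j _ => by ring
  have hle : ∀ (V : ℝ → Fin m → ℂ) (c : ℝ≥0), (∀ t, ‖V t‖₊ ≤ c * D.w t) → ∀ t,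
      ‖Φ V t‖₊ ≤ ((∑ i, ∑ j, ‖A i j‖₊) * (1 + c * D.η) + c * (1 / 2)) * D.w t := by
    intro V c hc t
    refine pi_nnnorm_le_iff.mpr fun i => ?_
    refine (hbound (fun _ => D.forcing V) (1 + c * D.η) c t (Φ V t)
      (fun j => D.nnnorm_integral_mul_le (D.enorm_forcing_le hc) j t) (fun i => rfl) i).trans ?_
    refine mul_le_mul_left (add_le_add (mul_le_mul_left ?_ _) (mul_le_mul_right (hM i) _)) _
    exact Finset.single_le_sum (f := fun i => ∑ j, ‖A i j‖₊) (fun _ _ => zero_le)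
      (Finset.mem_univ i)
  suffices h : ∃ V ∈ S, (∀ t, Φ V t = V t) ∧ ∃ c : ℝ≥0, ∀ t, ‖V t - (0 : ℝ → Fin m → ℂ) t‖₊ ≤ c * D.w t by
    obtain ⟨V, ⟨hVm, c, hVc⟩, hVf, -⟩ := h
    exact ⟨V, c, hVm, hVc, fun t i => congrFun (hVf t).symm i⟩
  refine exists_fixedPoint_of_weighted D.w S Φ (3 / 4)
    ((∑ i, ∑ j, ‖A i j‖₊) * (1 + 0 * D.η) + 0 * (1 / 2)) (by
      rw [← NNReal.coe_lt_coe]; norm_num) ?_ ?_ 0 ⟨aestronglyMeasurable_const, 0, by simp⟩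
    (fun t => by simpa using hle 0 0 (by simp) t) ?_
  · rintro V ⟨hVm, c, hVc⟩
    refine ⟨?_, _, hle V c hVc⟩
    refine (aemeasurable_pi_lambda _ fun i => ?_).aestronglyMeasurable
    refine AEStronglyMeasurable.aemeasurable ?_
    refine Finset.aestronglyMeasurable_fun_sum _ fun j _ => ?_
    exact (((D.measurable_g j).aestronglyMeasurable.mul
      (D.aestronglyMeasurable_forcing hVm).comp_snd).integral_prod_right').const_mul _
  · rintro V ⟨hVm, cV, hVc⟩ W ⟨hWm, cW, hWc⟩ c hc t
    refine pi_nnnorm_le_iff.mpr fun i => ?_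
    refine (hbound (fun _ s => D.forcing V s - D.forcing W s) (c * D.η) c t (Φ V t - Φ W t)
      (fun j => D.nnnorm_integral_mul_le (D.enorm_forcing_sub_le hVm hWm hVc hWc hc) j t)
      (fun i => ?_) i).trans ?_
    · simp only [hΦ, Pi.sub_apply]
      rw [← Finset.sum_sub_distrib]
      refine Finset.sum_congr rfl fun j _ => ?_
      rw [← mul_sub, ← integral_sub
        (D.integrable_mul (D.aestronglyMeasurable_forcing hVm) (D.enorm_forcing_le hVc) j t)
        (D.integrable_mul (D.aestronglyMeasurable_forcing hWm) (D.enorm_forcing_le hWc) j t)]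
      simp only [mul_sub]
    · gcongr
      calc (∑ j, ‖A i j‖₊) * (c * D.η) + c * ∑ j, ‖A i j‖₊ * ∑ k, D.M j k
          = c * ((∑ j, ‖A i j‖₊) * D.η + ∑ j, ‖A i j‖₊ * ∑ k, D.M j k) := by ring
        _ ≤ c * (1 / 4 + 1 / 2) := by gcongr; exacts [hA i, hM i]
        _ = 3 / 4 * c := by
          rw [← NNReal.coe_inj]; push_cast; ring
  · rintro F f hF hlim ⟨c, hc⟩
    refine ⟨aestronglyMeasurable_of_tendsto_ae atTop (fun k => (hF k).1)
      (Eventually.of_forall hlim), ?_⟩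
    obtain ⟨c₀, h₀⟩ := (hF 0).2
    refine ⟨c + c₀, fun t => ?_⟩
    calc ‖f t‖₊ = ‖(f t - F 0 t) + F 0 t‖₊ := by rw [sub_add_cancel]
      _ ≤ _ := (nnnorm_add_le _ _).trans (by
        rw [add_mul]; exact add_le_add (hc t) (h₀ t))

end GreenData

/-! ### Backward continuation of linear systems -/

/-- Uniform smallness of exponentially damped tails of an integrable function. -/
theorem exists_lintegral_exp_mul_le {N : ℝ → ℝ≥0∞} (hN : AEMeasurable N)
    (hfin : ∫⁻ s, N s ≠ ∞) {ε : ℝ≥0∞} (hε : ε ≠ 0) :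
    ∃ K : ℝ, 0 ≤ K ∧ ∀ t,
      ∫⁻ s in Ioi t, N s * ENNReal.ofReal (Real.exp (-(K * (s - t)))) ≤ ε := by
  have hε2 : ε / 2 ≠ 0 := by simpa using hε
  -- Near part `(t, t+d]`: small by absolute continuity of the integral, uniformly in `t`. Far part:
  -- damped by `e^{-Kd}`.
  obtain ⟨δ, hδ0, hδ⟩ := exists_pos_setLIntegral_lt_of_measure_lt hfin hε2
  obtain ⟨d, hd0, hd⟩ : ∃ d : ℝ, 0 < d ∧ ENNReal.ofReal d < δ := by
    obtain ⟨d, hd0, hd⟩ := ENNReal.lt_iff_exists_nnreal_btwn.mp hδ0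
    exact ⟨d, by exact_mod_cast hd0, by simpa using hd⟩
  have hlim : Tendsto (fun K : ℝ => ENNReal.ofReal (Real.exp (-(K * d))) * ∫⁻ s, N s)
      atTop (𝓝 0) := by
    have h1 : Tendsto (fun K : ℝ => ENNReal.ofReal (Real.exp (-(K * d)))) atTop (𝓝 0) := by
      rw [← ENNReal.ofReal_zero]
      exact ENNReal.tendsto_ofReal (Real.tendsto_exp_neg_atTop_nhds_zero.comp
        (tendsto_id.atTop_mul_const hd0))
    simpa using ENNReal.Tendsto.mul_const h1 (Or.inr hfin)
  obtain ⟨K, hK, hK0⟩ := ((hlim.eventually (gt_mem_nhds (pos_iff_ne_zero.mpr hε2))).and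
    (eventually_ge_atTop 0)).exists
  refine ⟨K, hK0, fun t => ?_⟩
  calc ∫⁻ s in Ioi t, N s * ENNReal.ofReal (Real.exp (-(K * (s - t))))
      ≤ ∫⁻ s, ((Ioc t (t + d)).indicator N s + ENNReal.ofReal (Real.exp (-(K * d))) * N s) := by
        rw [← lintegral_indicator measurableSet_Ioi]
        refine lintegral_mono (indicator_le fun s (hs : s ∈ Ioi t) => ?_)
        have hs' : t < s := hs
        by_cases h : s ≤ t + d
        · rw [indicator_of_mem (show s ∈ Ioc t (t + d) from ⟨hs, h⟩)]
          refine le_add_right (mul_le_of_le_one_right' ?_)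
          rw [← ENNReal.ofReal_one]
          refine ENNReal.ofReal_le_ofReal (Real.exp_le_one_iff.mpr ?_)
          nlinarith
        · refine le_add_left ?_
          rw [mul_comm]
          refine mul_le_mul_left (ENNReal.ofReal_le_ofReal (Real.exp_le_exp.mpr ?_)) _
          nlinarith
    _ = (∫⁻ s in Ioc t (t + d), N s) + ENNReal.ofReal (Real.exp (-(K * d))) * ∫⁻ s, N s := by
        rw [lintegral_add_right' _ (hN.const_mul _), lintegral_indicator measurableSet_Ioc,
          lintegral_const_mul'' _ hN]
    _ ≤ ε / 2 + ε / 2 := add_le_add (hδ _ (by simpa using hd)).le hK.le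
    _ = ε := ENNReal.add_halves ε

/-- Backward solution of a linear integral equation with integrable coefficients. -/
theorem exists_backward_solution {ι : Type*} [Fintype ι] {A : ι → ι → ℝ → ℂ}
    (hA : ∀ i j, Integrable (A i j)) {t₀ T : ℝ} (hT : t₀ ≤ T)
    (hs : ∀ i j s, s ∉ Ioc t₀ T → A i j s = 0) (x₀ : ι → ℂ) :
    ∃ X : ℝ → ι → ℂ, (∀ t, T ≤ t → X t = x₀) ∧
      ∀ i, IsPrimitive (fun t => X t i) fun t => ∑ j, A i j t * X t j := by
  set N : ℝ → ℝ≥0∞ := fun s => ∑ i, ∑ j, ‖A i j s‖ₑ with hNdef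
  have hAm : ∀ i j, AEMeasurable fun s => ‖A i j s‖ₑ := fun i j => (hA i j).1.enorm
  have hNm : AEMeasurable N := Finset.aemeasurable_fun_sum _ fun i _ =>
    Finset.aemeasurable_fun_sum _ fun j _ => hAm i j
  have hNfin : ∫⁻ s, N s ≠ ∞ := by
    simp only [hNdef]
    rw [lintegral_finsetSum' _ fun i _ => Finset.aemeasurable_fun_sum _ fun j _ => hAm i j]
    refine ENNReal.sum_ne_top.mpr fun i _ => ?_
    rw [lintegral_finsetSum' _ fun j _ => hAm i j]
    exact ENNReal.sum_ne_top.mpr fun j _ => (hA i j).2.ne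
  obtain ⟨K, hK0, hK⟩ := exists_lintegral_exp_mul_le hNm hNfin (ε := 1 / 2) (by simp)
  -- Bielecki weight `e^{K(T-t)}`, with `t` clamped to `[t₀,T]` so that the weight stays between `1`
  -- and a constant on the whole line. The choice of `K` makes the Volterra operator a contraction
  -- by `1/2` on an interval of any length.
  set cl : ℝ → ℝ := fun t => max t₀ (min t T) with hcl
  set w : ℝ → ℝ≥0 := fun t => (Real.exp (K * (T - cl t))).toNNReal with hw
  have hwc : ∀ t, (w t : ℝ≥0∞) = ENNReal.ofReal (Real.exp (K * (T - cl t))) := fun t => rfl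
  have hclT : ∀ t, cl t ≤ T := fun t => max_le hT (min_le_right _ _)
  have hclt₀ : ∀ t, t₀ ≤ cl t := fun t => le_max_left _ _
  have hw1 : ∀ t, 1 ≤ w t := fun t => by
    rw [hw, ← NNReal.coe_le_coe, Real.coe_toNNReal _ (Real.exp_pos _).le]
    exact Real.one_le_exp (mul_nonneg hK0 (sub_nonneg.mpr (hclT t)))
  have hwC : ∀ t, w t ≤ (Real.exp (K * (T - t₀))).toNNReal := fun t =>
    Real.toNNReal_le_toNNReal (Real.exp_le_exp.mpr
      (mul_le_mul_of_nonneg_left (by linarith [hclt₀ t]) hK0))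
  have hest : ∀ t, ∫⁻ s in Ioi t, N s * w s ≤ 1 / 2 * w t := fun t => by
    have hsub : ∫⁻ s in Ioi t, N s * w s ≤
        ∫⁻ s in Ioi (cl t), N s * ENNReal.ofReal (Real.exp (-(K * (s - cl t)))) * w t := by
      rw [← lintegral_indicator measurableSet_Ioi, ← lintegral_indicator measurableSet_Ioi]
      refine lintegral_mono fun s => indicator_le (fun s (hst : t < s) => ?_) s
      by_cases hsI : s ∈ Ioc t₀ T
      · have hlt : cl t < s := max_lt hsI.1 ((min_le_left _ _).trans_lt hst)
        have hcs : cl s = s := by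
          simp only [hcl]; rw [min_eq_left hsI.2, max_eq_right hsI.1.le]
        rw [indicator_of_mem (show s ∈ Ioi (cl t) from hlt), mul_assoc]
        refine mul_le_mul_right ?_ _
        rw [hwc, hwc, hcs, ← ENNReal.ofReal_mul (Real.exp_pos _).le, ← Real.exp_add]
        refine ENNReal.ofReal_le_ofReal (Real.exp_le_exp.mpr (le_of_eq (by ring)))
      · have : N s = 0 := by simp [hNdef, hs _ _ s hsI]
        simp [this]
    refine hsub.trans ?_
    rw [lintegral_mul_const' _ _ ENNReal.coe_ne_top]
    exact mul_le_mul_left (hK (cl t)) _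
  have hmul : ∀ (v : ι → ℂ) (c : ℝ≥0) (s : ℝ), ‖v‖₊ ≤ c * w s → ∀ i,
      ‖∑ j, A i j s * v j‖ₑ ≤ c * (N s * w s) := fun v c s hv i => by
    calc ‖∑ j, A i j s * v j‖ₑ ≤ ∑ j, ‖A i j s‖ₑ * (c * w s) := by
          refine (enorm_sum_le _ _).trans (Finset.sum_le_sum fun j _ => ?_)
          rw [enorm_mul]
          refine mul_le_mul_right ?_ _
          rw [enorm_eq_nnnorm]
          exact_mod_cast (nnnorm_le_pi_nnnorm v j).trans hv
      _ = (∑ j, ‖A i j s‖ₑ) * (c * w s) := (Finset.sum_mul _ _ _).symm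
      _ ≤ N s * (c * w s) := by
          refine mul_le_mul_left ?_ _
          exact Finset.single_le_sum (f := fun i => ∑ j, ‖A i j s‖ₑ) (fun _ _ => zero_le)
            (Finset.mem_univ i)
      _ = c * (N s * w s) := by ring
  have hsm : ∀ X : ℝ → ι → ℂ, AEStronglyMeasurable X → ∀ i,
      AEStronglyMeasurable fun s => ∑ j, A i j s * X s j := fun X hX i =>
    Finset.aestronglyMeasurable_fun_sum _ fun j _ =>
      (hA i j).1.mul ((continuous_apply j).comp_aestronglyMeasurable hX)
  have hint : ∀ X : ℝ → ι → ℂ, AEStronglyMeasurable X → ∀ c : ℝ≥0, (∀ t, ‖X t‖₊ ≤ c * w t) →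
      ∀ i, Integrable fun s => ∑ j, A i j s * X s j := fun X hX c hc i => by
    refine ⟨hsm X hX i, ?_⟩
    set C : ℝ≥0 := c * (Real.exp (K * (T - t₀))).toNNReal with hC
    refine (lintegral_mono (g := fun s => (C : ℝ≥0∞) * N s)
      fun s => (hmul _ c s (hc s) i).trans ?_).trans_lt ?_
    · change (c : ℝ≥0∞) * (N s * w s) ≤ C * N s
      rw [mul_left_comm, mul_comm _ (N s)]
      refine mul_le_mul_right ?_ _
      exact_mod_cast mul_le_mul_right (hwC s) c
    · rw [lintegral_const_mul'' _ hNm]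
      exact ENNReal.mul_lt_top ENNReal.coe_lt_top hNfin.lt_top
  have hbd : ∀ (h : ℝ → ℂ) (c : ℝ≥0), (∀ s, ‖h s‖ₑ ≤ c * (N s * w s)) → ∀ t,
      ‖∫ s in Ioi t, h s‖₊ ≤ 1 / 2 * c * w t := fun h c hh t => by
    have h1 : ‖∫ s in Ioi t, h s‖ₑ ≤ c * (1 / 2 * w t) := by
      refine (enorm_integral_le_lintegral_enorm _).trans ((lintegral_mono hh).trans ?_)
      rw [lintegral_const_mul' _ _ ENNReal.coe_ne_top]
      exact mul_le_mul_right (hest t) _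
    rw [enorm_eq_nnnorm, show (1 / 2 : ℝ≥0∞) = ((1 / 2 : ℝ≥0) : ℝ≥0∞) by simp] at h1
    rw [mul_comm (1 / 2 : ℝ≥0) c, mul_assoc]
    exact_mod_cast h1
  set Φ : (ℝ → ι → ℂ) → ℝ → ι → ℂ := fun X t i =>
    x₀ i - ∫ s in Ioi t, ∑ j, A i j s * X s j with hΦ
  set S : Set (ℝ → ι → ℂ) :=
    {X | AEStronglyMeasurable X ∧ ∃ c : ℝ≥0, ∀ t, ‖X t‖₊ ≤ c * w t} with hS
  have hprim : ∀ X ∈ S, ∀ i, IsPrimitive (fun t => Φ X t i) fun t => ∑ j, A i j t * X t j := by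
    rintro X ⟨hX, c, hc⟩ i
    have hi := hint X hX c hc i
    refine ⟨hi.locallyIntegrable, fun a b => ?_⟩
    rw [← intervalIntegral.integral_Ioi_sub_Ioi' hi.integrableOn hi.integrableOn]
    simp only [hΦ]
    ring
  have hΦle : ∀ X ∈ S, ∃ c : ℝ≥0, ∀ t, ‖Φ X t‖₊ ≤ c * w t := by
    rintro X ⟨hX, c, hc⟩
    refine ⟨‖x₀‖₊ + 1 / 2 * c, fun t => pi_nnnorm_le_iff.mpr fun i => ?_⟩
    refine (nnnorm_sub_le _ _).trans ?_
    rw [add_mul]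
    refine add_le_add ((nnnorm_le_pi_nnnorm x₀ i).trans (le_mul_of_one_le_right' (hw1 t))) ?_
    exact hbd _ c (fun s => hmul _ c s (hc s) i) t
  have h0S : (0 : ℝ → ι → ℂ) ∈ S := ⟨aestronglyMeasurable_const, 0, by simp⟩
  obtain ⟨b, hb⟩ := hΦle 0 h0S
  suffices h : ∃ X ∈ S, (∀ t, Φ X t = X t) ∧
      ∃ c : ℝ≥0, ∀ t, ‖X t - (0 : ℝ → ι → ℂ) t‖₊ ≤ c * w t by
    obtain ⟨X, hXS, hX, -⟩ := h
    refine ⟨X, fun t ht => ?_, fun i => (hprim X hXS i).congr (fun t => by rw [hX]) fun t => rfl⟩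
    rw [← hX]
    funext i
    simp only [hΦ]
    rw [setIntegral_eq_zero_of_forall_eq_zero, sub_zero]
    intro s hst
    refine Finset.sum_eq_zero fun j _ => ?_
    rw [hs i j s fun h => absurd (lt_of_le_of_lt ht hst) (not_lt.mpr h.2), zero_mul]
  refine exists_fixedPoint_of_weighted w S Φ (1 / 2) b (by
    rw [← NNReal.coe_lt_coe]; norm_num) ?_ ?_ 0 h0S (fun t => by simpa using hb t) ?_
  · intro X hX
    refine ⟨Continuous.aestronglyMeasurable ?_, hΦle X hX⟩
    exact continuous_pi fun i => (hprim X hX i).continuous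
  · rintro X ⟨hX, cX, hcX⟩ Z ⟨hZ, cZ, hcZ⟩ c hc t
    refine pi_nnnorm_le_iff.mpr fun i => ?_
    have h1 : (Φ X t - Φ Z t) i = -∫ s in Ioi t, ∑ j, A i j s * (X s - Z s) j := by
      have h2 : ∀ s, ∑ j, A i j s * (X s - Z s) j =
          ∑ j, A i j s * X s j - ∑ j, A i j s * Z s j := fun s => by
        rw [← Finset.sum_sub_distrib]
        exact Finset.sum_congr rfl fun j _ => by rw [Pi.sub_apply]; ring
      simp only [h2]
      rw [integral_sub (hint X hX cX hcX i).integrableOn (hint Z hZ cZ hcZ i).integrableOn]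
      simp only [hΦ, Pi.sub_apply]
      ring
    rw [h1, nnnorm_neg]
    exact hbd _ c (fun s => hmul _ c s (hc s) i) t
  · rintro F f hF hlim ⟨c, hc⟩
    refine ⟨aestronglyMeasurable_of_tendsto_ae atTop (fun k => (hF k).1)
      (Eventually.of_forall hlim), ?_⟩
    obtain ⟨c₀, h₀⟩ := (hF 0).2
    refine ⟨c + c₀, fun t => ?_⟩
    calc ‖f t‖₊ = ‖(f t - F 0 t) + F 0 t‖₊ := by rw [sub_add_cancel]
      _ ≤ _ := (nnnorm_add_le _ _).trans (by
        rw [add_mul]; exact add_le_add (hc t) (h₀ t))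

/-- Extension to the left of a solution of a linear system defined to the right of `T`. -/
theorem exists_extension {ι : Type*} [Fintype ι] {A : ι → ι → ℝ → ℂ}
    (hA : ∀ i j, LocallyIntegrable (A i j)) {t₀ T : ℝ} (hT : t₀ ≤ T) {Z G : ι → ℝ → ℂ}
    (hZ : ∀ i, IsPrimitive (Z i) (G i)) (hG : ∀ i t, T < t → G i t = ∑ j, A i j t * Z j t) :
    ∃ X : ι → ℝ → ℂ, (∀ i t, T ≤ t → X i t = Z i t) ∧
      ∀ i, IsPrimitive (X i) ((Ioi t₀).indicator fun t => ∑ j, A i j t * X j t) := by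
  obtain ⟨X, hX, hXp⟩ := exists_backward_solution (A := fun i j => (Ioc t₀ T).indicator (A i j))
    (fun i j => by
      rw [integrable_indicator_iff measurableSet_Ioc]
      exact ((hA i j).integrableOn_isCompact isCompact_Icc).mono_set Ioc_subset_Icc_self)
    hT (fun i j s hs => indicator_of_notMem hs _) fun i => Z i T
  -- Gluing by addition: right of `T` the backward solution is frozen at `Z(T)`, left of `T` the
  -- bracket vanishes, so the sum is a primitive with no matching argument at `T`.
  have hXT : ∀ i t, T ≤ t → X t i + (Z i (max t T) + -Z i T) = Z i t := fun i t ht => by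
    rw [hX t ht, max_eq_left ht]; ring
  refine ⟨fun i t => X t i + (Z i (max t T) + -Z i T), hXT, fun i => ?_⟩
  refine ((hXp i).add (((hZ i).comp_max T).add (IsPrimitive.const (-Z i T)))).congr
    (fun t => rfl) fun t => ?_
  rw [add_zero]
  rcases le_or_gt t T with h | h
  · rw [indicator_of_notMem (show t ∉ Ioi T from not_lt.mpr h), add_zero]
    by_cases h0 : t₀ < t
    · rw [indicator_of_mem (show t ∈ Ioi t₀ from h0)]
      refine Finset.sum_congr rfl fun j _ => ?_
      rw [indicator_of_mem (show t ∈ Ioc t₀ T from ⟨h0, h⟩)]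
      change _ = A i j t * (X t j + (Z j (max t T) + -Z j T))
      rw [max_eq_right h]
      ring
    · rw [indicator_of_notMem (show t ∉ Ioi t₀ from h0)]
      refine Finset.sum_eq_zero fun j _ => ?_
      rw [indicator_of_notMem fun h' => h0 h'.1, zero_mul]
  · rw [indicator_of_mem (show t ∈ Ioi T from h),
      indicator_of_mem (show t ∈ Ioi t₀ from hT.trans_lt h), hG i t h]
    rw [Finset.sum_eq_zero, zero_add]
    · exact Finset.sum_congr rfl fun j _ => congrArg (A i j t * ·) (hXT j t h.le).symm
    · intro j _
      rw [indicator_of_notMem fun h' => absurd h (not_lt.mpr h'.2), zero_mul]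

/-! ### Perturbation coefficients and integral tails -/

theorem eval_coeffPoly {m : ℕ} (c : Fin m → ℂ) (x : ℂ) :
    (coeffPoly c).eval x = ∑ i, c i * x ^ (i : ℕ) := by
  simp [coeffPoly, Polynomial.eval_finsetSum]

theorem natDegree_coeffPoly_le {m : ℕ} (c : Fin (m + 1) → ℂ) : (coeffPoly c).natDegree ≤ m := by
  refine Polynomial.natDegree_sum_le_of_forall_le _ _ fun i _ => ?_
  exact (Polynomial.natDegree_C_mul_X_pow_le _ _).trans (Nat.lt_succ_iff.mp i.2)

theorem pertDeriv_eq_sum {n : ℕ} (r : Fin n → ℝ → ℂ) (lam : ℂ) (k : ℕ) (t : ℝ) :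
    pertDeriv r lam k t =
      ∑ i : Fin n, (Polynomial.derivative^[k] (Polynomial.X ^ (i : ℕ) : ℂ[X])).eval lam * r i t := by
  rw [pertDeriv, coeffPoly, Polynomial.iterate_derivative_sum, Polynomial.eval_finsetSum]
  refine Finset.sum_congr rfl fun i _ => ?_
  rw [Polynomial.iterate_derivative_C_mul, Polynomial.eval_mul, Polynomial.eval_C, mul_comm]

theorem locallyIntegrable_indicator_Ici {t₀ : ℝ} {f : ℝ → ℂ}
    (hf : LocallyIntegrableOn f (Ici t₀)) : LocallyIntegrable ((Ici t₀).indicator f) := by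
  refine locallyIntegrable_iff.mpr fun K hK => ?_
  rw [IntegrableOn, integrable_indicator_iff measurableSet_Ici, IntegrableOn,
    Measure.restrict_restrict measurableSet_Ici]
  exact hf.integrableOn_compact_subset inter_subset_left (hK.inter_left isClosed_Ici)

theorem locallyIntegrable_sum {ι : Type*} (s : Finset ι) {f : ι → ℝ → ℂ}
    (h : ∀ i ∈ s, LocallyIntegrable (f i)) : LocallyIntegrable fun t => ∑ i ∈ s, f i t := by
  classical
  induction s using Finset.induction_on with
  | empty => simpa using (locallyIntegrable_zero : LocallyIntegrable (fun _ : ℝ => (0 : ℂ)))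
  | insert i s hi ih =>
    simp only [Finset.sum_insert hi]
    exact (h i (by simp)).add (ih fun j hj => h j (by simp [hj]))

theorem locallyIntegrable_indicator_pertDeriv {n : ℕ} {t₀ : ℝ} {r : Fin n → ℝ → ℂ}
    (hr : ∀ i, LocallyIntegrableOn (r i) (Ici t₀)) (lam : ℂ) (k : ℕ) :
    LocallyIntegrable ((Ici t₀).indicator (pertDeriv r lam k)) := by
  have h := locallyIntegrable_sum Finset.univ fun (i : Fin n) _ =>
    (locallyIntegrable_indicator_Ici (hr i)).smul
      ((Polynomial.derivative^[k] (Polynomial.X ^ (i : ℕ) : ℂ[X])).eval lam)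
  convert! h using 1
  funext t
  by_cases ht : t ∈ Ici t₀
  · simp [ht, pertDeriv_eq_sum]
  · simp [ht]

theorem tendsto_setLIntegral_Ici {f : ℝ → ℝ≥0∞} (hf : AEMeasurable f) (hfin : ∫⁻ s, f s ≠ ∞) :
    Tendsto (fun T => ∫⁻ s in Ici T, f s) atTop (𝓝 0) := by
  have h := tendsto_lintegral_filter_of_dominated_convergence' (μ := volume)
    (l := (atTop : Filter ℝ)) (F := fun T => (Ici T).indicator f) (f := fun _ => 0) f
    (Eventually.of_forall fun T => hf.indicator measurableSet_Ici)
    (Eventually.of_forall fun T => Eventually.of_forall fun s => indicator_le_self _ _ s) hfin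
    (Eventually.of_forall fun s => tendsto_const_nhds.congr' (by
      filter_upwards [eventually_gt_atTop s] with T hT
      rw [indicator_of_notMem (show s ∉ Ici T from not_le.mpr hT)]))
  rw [lintegral_zero] at h
  exact h.congr fun T => lintegral_indicator measurableSet_Ici _

theorem sum_Icc_one_eq_sum_fin {M : Type*} [AddCommMonoid M] (m : ℕ) (f : ℕ → M) :
    ∑ k ∈ Finset.Icc 1 m, f k = ∑ k : Fin m, f (k + 1) := by
  rw [Fin.sum_univ_eq_sum_range fun k => f (k + 1), Finset.range_eq_Ico,
    Finset.sum_Ico_add' f 0 m 1]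
  exact Finset.sum_congr (by ext; simp) fun _ _ => rfl

/-! ### The jet of the solution in diagonal coordinates -/

/-- The `i`-th derivative of the solution in terms of `u` and the diagonal coordinates `x j`. -/
noncomputable def jet {m : ℕ} (lam : ℂ) (γ : Fin m → ℂ) (t₀ : ℝ) (u : ℝ → ℂ) (x : Fin m → ℝ → ℂ)
    (i : ℕ) (t : ℝ) : ℂ :=
  Complex.exp (lam * ((t : ℂ) - t₀)) *
    (lam ^ i * u t + ∑ j, ((γ j + lam) ^ i - lam ^ i) / γ j * x j t)

section Jet

variable {m : ℕ} {lam : ℂ} {γ : Fin m → ℂ} (t₀ : ℝ) (u : ℝ → ℂ) (x : Fin m → ℝ → ℂ)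

theorem jet_zero (t : ℝ) : jet lam γ t₀ u x 0 t = Complex.exp (lam * ((t : ℂ) - t₀)) * u t := by
  simp [jet]

/-- The jet is linear in the monomial `Xⁱ`, through its value at `λ` and its difference quotients
between `λ` and `γⱼ + λ`; hence it extends to arbitrary polynomials. -/
theorem sum_mul_jet {n : ℕ} (c : Fin n → ℂ) (t : ℝ) :
    ∑ i, c i * jet lam γ t₀ u x i t = Complex.exp (lam * ((t : ℂ) - t₀)) *
      ((coeffPoly c).eval lam * u t +
        ∑ j, ((coeffPoly c).eval (γ j + lam) - (coeffPoly c).eval lam) / γ j * x j t) := by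
  simp only [jet, eval_coeffPoly]
  rw [mul_add, Finset.sum_mul, Finset.mul_sum, Finset.mul_sum]
  have h : ∀ j, Complex.exp (lam * ((t : ℂ) - t₀)) *
      ((∑ i, c i * (γ j + lam) ^ (i : ℕ) - ∑ i, c i * lam ^ (i : ℕ)) / γ j * x j t) =
      ∑ i, c i * (Complex.exp (lam * ((t : ℂ) - t₀)) *
        (((γ j + lam) ^ (i : ℕ) - lam ^ (i : ℕ)) / γ j * x j t)) := fun j => by
    rw [← Finset.sum_sub_distrib, Finset.sum_div, Finset.sum_mul, Finset.mul_sum]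
    exact Finset.sum_congr rfl fun i _ => by ring
  simp only [h]
  rw [Finset.sum_comm, ← Finset.sum_add_distrib]
  refine Finset.sum_congr rfl fun i _ => ?_
  rw [mul_add, mul_add, Finset.mul_sum, Finset.mul_sum]
  congr 1
  ring

/-- At each of the nodes `λ`, `γⱼ + λ` the characteristic equation expresses `z^{m+1}` through lower
powers. -/
theorem jet_top_eq {a : Fin (m + 1) → ℂ} (hlam : (charPoly a).IsRoot lam)
    (hmu : ∀ j, (charPoly a).IsRoot (γ j + lam)) (t : ℝ) :
    jet lam γ t₀ u x (m + 1) t = -∑ i, a i * jet lam γ t₀ u x i t := by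
  have hroot : ∀ z, (charPoly a).IsRoot z → (coeffPoly a).eval z = -z ^ (m + 1) := fun z hz => by
    have : z ^ (m + 1) + (coeffPoly a).eval z = 0 := by simpa [charPoly] using hz
    linear_combination this
  rw [sum_mul_jet, hroot _ hlam]
  simp only [hroot _ (hmu _), jet]
  rw [← mul_neg, neg_add, ← Finset.sum_neg_distrib]
  congr 2
  · ring
  · exact Finset.sum_congr rfl fun j _ => by ring

/-- Taylor expansion at `λ`: the difference quotient removes the constant term and one power of
`γⱼ`, which leaves the derivatives of order `1, …, m` paired with `∑ⱼ γⱼᵏ xⱼ`. -/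
theorem sum_pert_mul_jet (hγ0 : ∀ j, γ j ≠ 0) (r : Fin (m + 1) → ℝ → ℂ) (t : ℝ) :
    ∑ i, r i t * jet lam γ t₀ u x i t = Complex.exp (lam * ((t : ℂ) - t₀)) *
      (pertDeriv r lam 0 t * u t + ∑ k : Fin m,
        pertDeriv r lam (k + 1) t / ((k : ℕ) + 1).factorial * ∑ j, γ j ^ (k : ℕ) * x j t) := by
  rw [sum_mul_jet]
  congr 2
  have h : ∀ j, ((coeffPoly fun i => r i t).eval (γ j + lam) -
      (coeffPoly fun i => r i t).eval lam) / γ j =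
      ∑ k : Fin m, pertDeriv r lam (k + 1) t / ((k : ℕ) + 1).factorial * γ j ^ (k : ℕ) := by
    intro j
    rw [eval_add_eq_sum_iterate_derivative (natDegree_coeffPoly_le _), Finset.sum_range_succ',
      ← Fin.sum_univ_eq_sum_range (fun k => (Polynomial.derivative^[k + 1]
        (coeffPoly fun i => r i t)).eval lam / (k + 1).factorial * γ j ^ (k + 1))]
    simp only [Function.iterate_zero, id_eq, Nat.factorial_zero, Nat.cast_one, div_one, pow_zero,
      mul_one, add_sub_cancel_right]
    rw [Finset.sum_div]
    refine Finset.sum_congr rfl fun k _ => ?_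
    rw [pertDeriv, pow_succ, ← mul_assoc, mul_div_assoc, div_self (hγ0 j), mul_one]
  simp only [h, Finset.sum_mul, Finset.mul_sum]
  rw [Finset.sum_comm]
  exact Finset.sum_congr rfl fun k _ => Finset.sum_congr rfl fun j _ => by ring

variable {t₀ u x}

theorem isPrimitive_jet_aux (hγ0 : ∀ j, γ j ≠ 0) {h : ℝ → ℂ}
    (hu : IsPrimitive u fun t => ∑ j, x j t)
    (hx : ∀ j, IsPrimitive (x j) fun t => γ j * x j t + (gammaProd γ j)⁻¹ * h t) (i : ℕ) :
    IsPrimitive (jet lam γ t₀ u x i) fun t => jet lam γ t₀ u x (i + 1) t +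
      Complex.exp (lam * ((t : ℂ) - t₀)) *
        ((∑ j, ((γ j + lam) ^ i - lam ^ i) / γ j / gammaProd γ j) * h t) := by
  refine (((hu.const_mul (lam ^ i)).add (IsPrimitive.sum Finset.univ fun j _ =>
    (hx j).const_mul (((γ j + lam) ^ i - lam ^ i) / γ j))).exp_mul lam t₀).congr
    (fun t => rfl) fun t => ?_
  simp only [jet]
  rw [← mul_left_comm, ← mul_add, ← mul_add]
  congr 1
  rw [mul_add, Finset.mul_sum, Finset.mul_sum, Finset.sum_mul, add_assoc, add_assoc,
    ← Finset.sum_add_distrib, ← Finset.sum_add_distrib, ← Finset.sum_add_distrib]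
  congr 1
  · ring
  · refine Finset.sum_congr rfl fun j _ => ?_
    have := hγ0 j
    field_simp
    ring

/-- By partial fractions the multiple of `h` produced by differentiating the `i`-th entry is the
coefficient of `X^m` in `(X+λ)^i`: zero for `i < m`, one for `i = m`. The weights `1/Γⱼ` are chosen
for this. -/
theorem isPrimitive_jet (hm : 0 < m) (hγ : Function.Injective γ) (hγ0 : ∀ j, γ j ≠ 0) {h : ℝ → ℂ}
    (hu : IsPrimitive u fun t => ∑ j, x j t)
    (hx : ∀ j, IsPrimitive (x j) fun t => γ j * x j t + (gammaProd γ j)⁻¹ * h t) {i : ℕ}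
    (hi : i ≤ m) :
    IsPrimitive (jet lam γ t₀ u x i) fun t => jet lam γ t₀ u x (i + 1) t +
      if i = m then Complex.exp (lam * ((t : ℂ) - t₀)) * h t else 0 := by
  refine (isPrimitive_jet_aux hγ0 hu hx i).congr (fun t => rfl) fun t => ?_
  have hs := sum_div_gammaProd hm hγ hγ0 lam (f := Polynomial.X ^ i)
    ((Polynomial.natDegree_X_pow_le i).trans hi)
  simp only [Polynomial.eval_pow, Polynomial.eval_X] at hs
  rw [hs, Polynomial.taylor_X_pow, Polynomial.coeff_X_add_C_pow]
  split_ifs with h'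
  · simp [h']
  · rw [Nat.choose_eq_zero_of_lt (lt_of_le_of_ne hi h')]
    simp

end Jet

/-! ### Construction of the coordinates -/

theorem norm_pow_le_alphaTilde {m : ℕ} (γ : Fin m → ℂ) (i j : Fin m) :
    ‖γ j‖ ^ (i : ℕ) ≤ alphaTilde γ j :=
  Finset.single_le_sum (f := fun i => ‖γ j‖ ^ i) (fun _ _ => by positivity)
    (Finset.mem_range.mpr i.2)

theorem alphaTilde_pos {m : ℕ} (γ : Fin m → ℂ) (j : Fin m) : 0 < alphaTilde γ j := by
  have h := norm_pow_le_alphaTilde γ ⟨0, j.pos⟩ j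
  rw [pow_zero] at h
  linarith

theorem gammaProd_ne_zero {m : ℕ} {γ : Fin m → ℂ} (hγ : Function.Injective γ) (j : Fin m) :
    gammaProd γ j ≠ 0 :=
  Finset.prod_ne_zero_iff.mpr fun _ hk =>
    sub_ne_zero.mpr fun h => (Finset.ne_of_mem_erase hk) (hγ h).symm

/-- Existence, to the right of a large `T`, of the coordinates of the solution. -/
theorem exists_coordinates {m : ℕ} (hm : 0 < m) {t₀ : ℝ} {r : Fin (m + 1) → ℝ → ℂ}
    (hr : ∀ i, LocallyIntegrableOn (r i) (Ici t₀)) {lam : ℂ} {γ : Fin m → ℂ}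
    (hγ : Function.Injective γ) (hP : IntegrableOn (pertDeriv r lam 0) (Ici t₀)) {β : ℝ}
    (hβ0 : 0 < β) (hβ : ∀ j, β < |(γ j).re|) (hcl : smallness t₀ r lam γ β < 1 / 2) :
    ∃ T, t₀ ≤ T ∧ ∃ (u : ℝ → ℂ) (x : Fin m → ℝ → ℂ) (h : ℝ → ℂ) (C : ℝ≥0),
      IsPrimitive u (fun t => ∑ j, x j t) ∧
      (∀ j, IsPrimitive (x j) fun t => γ j * x j t + (gammaProd γ j)⁻¹ * h t) ∧
      (∀ t, T < t → h t = -(pertDeriv r lam 0 t * u t + ∑ k : Fin m,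
        pertDeriv r lam (k + 1) t / ((k : ℕ) + 1).factorial * ∑ j, γ j ^ (k : ℕ) * x j t)) ∧
      (∀ j t, ‖x j t‖ₑ ≤ C * dichInt t₀ β (pertDeriv r lam 0) t) ∧
      ∀ t, ‖u t - 1‖ₑ ≤ C * ∫⁻ s in Ioi t, dichInt t₀ β (pertDeriv r lam 0) s := by
  have : NeZero m := ⟨hm.ne'⟩
  set p : ℕ → ℝ → ℂ := fun k => (Ici t₀).indicator (pertDeriv r lam k) with hp
  have hpl : ∀ k, LocallyIntegrable (p k) := fun k =>
    locallyIntegrable_indicator_pertDeriv hr lam k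
  have hpm : ∀ k, AEStronglyMeasurable (p k) := fun k => (hpl k).aestronglyMeasurable
  have hp0 : Integrable (p 0) := by rwa [hp, integrable_indicator_iff measurableSet_Ici]
  have hre : ∀ j, (γ j).re ≠ 0 := fun j => (shift_re_ne_zero_and_sign hβ0 (hβ j)).2.2.2
  set om : Fin m → ℂ := fun j => (((γ j).re - Real.sign (γ j).re * β : ℝ) : ℂ) with hom
  have homre : ∀ j, (om j).re ≠ 0 := fun j => by
    simpa [hom] using (shift_re_ne_zero_and_sign hβ0 (hβ j)).2.2.1
  set N : Fin m → ℕ → ℝ≥0∞ := fun j k =>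
    ⨆ t ∈ Ici t₀, greenInt t₀ (om j) (pertDeriv r lam k) t with hN
  have hgreen : ∀ j k t, ∫⁻ s, ‖greenKernel (om j) t s‖ₑ * ‖p k s‖ₑ ≤ N j k := fun j k t => by
    rw [hp, ← greenInt_eq_lintegral_indicator]
    rcases le_total t₀ t with ht | ht
    · exact le_iSup₂ (f := fun t (_ : t ∈ Ici t₀) => greenInt t₀ (om j) (pertDeriv r lam k) t) t ht
    · exact (greenInt_le_of_le (homre j) _ ht).trans (le_iSup₂ (f := fun t (_ : t ∈ Ici t₀) =>
        greenInt t₀ (om j) (pertDeriv r lam k) t) t₀ self_mem_Ici)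
  have hsmall : ∑ j, ∑ k : Fin m, ENNReal.ofReal (alphaTilde γ j /
      ((((k : ℕ) + 1).factorial : ℝ) * ‖gammaProd γ j‖)) * N j (k + 1) < 1 / 2 := by
    refine lt_of_eq_of_lt ?_ hcl
    refine Finset.sum_congr rfl fun j _ => ?_
    exact (sum_Icc_one_eq_sum_fin m fun k => ENNReal.ofReal (alphaTilde γ j /
      ((k.factorial : ℝ) * ‖gammaProd γ j‖)) * N j k).symm
  -- Finiteness of each supremum is forced by (2), because its coefficient there is positive.
  have hNfin : ∀ j (k : Fin m), N j (k + 1) ≠ ∞ := fun j k htop => by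
    have hc : ENNReal.ofReal (alphaTilde γ j /
        ((((k : ℕ) + 1).factorial : ℝ) * ‖gammaProd γ j‖)) ≠ 0 := by
      have h1 := alphaTilde_pos γ j
      have h2 := norm_pos_iff.mpr (gammaProd_ne_zero hγ j)
      rw [Ne, ENNReal.ofReal_eq_zero, not_le]
      positivity
    have h1 := ENNReal.sum_lt_top.mp (ENNReal.sum_lt_top.mp (hsmall.trans (by simp)) j
      (Finset.mem_univ j)) k (Finset.mem_univ k)
    rw [htop, ENNReal.mul_top hc] at h1
    exact lt_irrefl _ h1
  set A : Fin m → Fin m → ℂ := fun i j => γ j ^ (i : ℕ) * (gammaProd γ j)⁻¹ with hA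
  obtain ⟨C₀, hC₀⟩ := exists_lintegral_expAvg_le hβ0
  -- `T` is chosen so that the tail term contributes at most `1/4`.
  obtain ⟨T, hT, hTsmall⟩ : ∃ T, t₀ ≤ T ∧
      ((∑ i, ∑ j, ‖A i j‖₊ : ℝ≥0) : ℝ≥0∞) * (C₀ * ∫⁻ s in Ici T, ‖p 0 s‖ₑ) ≤ 1 / 4 := by
    have h1 := ENNReal.Tendsto.const_mul (ENNReal.Tendsto.const_mul
      (tendsto_setLIntegral_Ici (hpm 0).enorm hp0.2.ne) (Or.inr (ENNReal.coe_ne_top (r := C₀))))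
      (Or.inr (ENNReal.coe_ne_top (r := ∑ i, ∑ j, ‖A i j‖₊)))
    rw [mul_zero, mul_zero] at h1
    obtain ⟨T, h2, h3⟩ := ((h1.eventually (gt_mem_nhds (show (0 : ℝ≥0∞) < 1 / 4 by simp))).and
      (eventually_ge_atTop t₀)).exists
    exact ⟨T, h3, h2.le⟩
  -- Only `P(r;λ)` is cut at `T`; the derivatives of order `k ≥ 1` keep their values on all of
  -- `[t₀,∞)`, where (2) controls them. Hence `h` has the required form only for `t > T`.
  set q : ℝ → ℂ := (Ici T).indicator (pertDeriv r lam 0) with hq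
  have hqp : q = (Ici T).indicator (p 0) := by
    rw [hp, indicator_indicator, inter_eq_left.mpr (Ici_subset_Ici.mpr hT)]
  have hqi : Integrable q := hqp ▸ hp0.indicator measurableSet_Ici
  have hqfin : ∫⁻ s, ‖q s‖ₑ ≠ ∞ := hqi.2.ne
  have hqint : ∫⁻ s, ‖q s‖ₑ = ∫⁻ s in Ici T, ‖p 0 s‖ₑ := by
    rw [← lintegral_indicator measurableSet_Ici, hqp]
    exact lintegral_congr fun s => by by_cases hs : s ∈ Ici T <;> simp [hs]
  set w : ℝ → ℝ≥0 := fun t => (expAvg β q t).toNNReal with hw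
  have hwc : ∀ t, (w t : ℝ≥0∞) = expAvg β q t := fun t =>
    ENNReal.coe_toNNReal ((expAvg_le_lintegral hβ0 q t).trans_lt hqfin.lt_top).ne
  have hwd : ∀ t, (w t : ℝ≥0∞) ≤ dichInt t₀ β (pertDeriv r lam 0) t := fun t => by
    rw [hwc, dichInt_eq_expAvg hβ0 (hpm 0)]
    refine lintegral_mono fun s => mul_le_mul_right ?_ _
    rw [hqp]
    by_cases hs : s ∈ Ici T <;> simp [hs, hp]
  let D : GreenData m :=
    { g := fun j => greenKernel (γ j)
      q := q
      b := fun k s => ((((k : ℕ) + 1).factorial : ℂ))⁻¹ * p (k + 1) s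
      w := w
      M := fun j k => ((((k : ℕ) + 1).factorial : ℝ≥0))⁻¹ * (N j (k + 1)).toNNReal
      η := C₀ * (∫⁻ s, ‖q s‖ₑ).toNNReal
      measurable_g := fun j => measurable_greenKernel _
      aesm_q := hqi.1
      aesm_b := fun k => (hpm _).const_mul _
      aemeasurable_w := (aemeasurable_expAvg β hqi.1).ennreal_toNNReal
      lintegral_q_le := fun j t => by
        rw [hwc]
        exact lintegral_mono fun s =>
          mul_le_mul_left (enorm_greenKernel_le (hre j) (hβ j).le t s) _
      lintegral_b_le := fun j k t => by
        have hmeas : AEMeasurable fun s => ‖greenKernel (om j) t s‖ₑ * ‖p (k + 1) s‖ₑ :=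
          ((measurable_greenKernel _).comp
            (measurable_prodMk_left (x := t))).enorm.aemeasurable.mul (hpm _).enorm
        have hf : ‖((((k : ℕ) + 1).factorial : ℂ))⁻¹‖ₑ =
            (((((k : ℕ) + 1).factorial : ℝ≥0))⁻¹ : ℝ≥0) := by
          rw [enorm_eq_nnnorm, nnnorm_inv]
          simp
        calc ∫⁻ s, ‖greenKernel (γ j) t s‖ₑ *
              (‖((((k : ℕ) + 1).factorial : ℂ))⁻¹ * p (k + 1) s‖ₑ * w s)
            ≤ ∫⁻ s, (((((k : ℕ) + 1).factorial : ℝ≥0))⁻¹ * w t : ℝ≥0) *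
                (‖greenKernel (om j) t s‖ₑ * ‖p (k + 1) s‖ₑ) := by
              refine lintegral_mono fun s => ?_
              have h1 : _ ≤ ‖greenKernel (om j) t s‖ₑ * _ :=
                enorm_greenKernel_mul_expAvg_le hβ0 (hβ j) hqi.1 t s
              rw [← hwc, ← hwc] at h1
              change _ * (_ * _) ≤ _ * _
              rw [enorm_mul, hf]
              calc _ = (((((k : ℕ) + 1).factorial : ℝ≥0))⁻¹ : ℝ≥0) * ‖p (k + 1) s‖ₑ *
                    (‖greenKernel (γ j) t s‖ₑ * w s) := by ring
                _ ≤ _ := mul_le_mul_right h1 _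
                _ = _ := by push_cast; ring
          _ ≤ (((((k : ℕ) + 1).factorial : ℝ≥0))⁻¹ * w t : ℝ≥0) * N j (k + 1) := by
              rw [lintegral_const_mul'' _ hmeas]
              exact mul_le_mul_right (hgreen j _ t) _
          _ = _ := by
              rw [← ENNReal.coe_toNNReal (hNfin j k)]
              norm_cast
              ring
      lintegral_w_le := by
        simp only [hwc]
        rw [ENNReal.coe_mul, ENNReal.coe_toNNReal hqfin]
        exact hC₀ q hqi.1 }
  have hM : ∀ i, ∑ j, ‖A i j‖₊ * ∑ k, D.M j k ≤ 1 / 2 := fun i => by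
    rw [← ENNReal.coe_le_coe, show ((1 / 2 : ℝ≥0) : ℝ≥0∞) = 1 / 2 by simp]
    refine le_trans ?_ hsmall.le
    rw [ENNReal.ofNNReal_finsetSum]
    refine Finset.sum_le_sum fun j _ => ?_
    rw [Finset.mul_sum, ENNReal.ofNNReal_finsetSum]
    refine Finset.sum_le_sum fun k _ => ?_
    change ((‖A i j‖₊ * (((((k : ℕ) + 1).factorial : ℝ≥0))⁻¹ * (N j (k + 1)).toNNReal) : ℝ≥0) :
      ℝ≥0∞) ≤ _
    rw [← mul_assoc, ENNReal.coe_mul, ENNReal.coe_toNNReal (hNfin j k)]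
    refine mul_le_mul_left ?_ _
    rw [← ENNReal.ofReal_coe_nnreal]
    refine ENNReal.ofReal_le_ofReal ?_
    push_cast
    rw [hA, norm_mul, norm_pow, norm_inv, div_eq_mul_inv, mul_inv, mul_assoc,
      mul_comm ‖gammaProd γ j‖⁻¹]
    exact mul_le_mul_of_nonneg_right (norm_pow_le_alphaTilde γ i j) (by positivity)
  have hAη : ∀ i, (∑ j, ‖A i j‖₊) * D.η ≤ 1 / 4 := fun i => by
    rw [← ENNReal.coe_le_coe, show ((1 / 4 : ℝ≥0) : ℝ≥0∞) = 1 / 4 by simp]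
    refine le_trans ?_ hTsmall
    rw [ENNReal.coe_mul]
    change _ * ((C₀ * (∫⁻ s, ‖q s‖ₑ).toNNReal : ℝ≥0) : ℝ≥0∞) ≤ _
    rw [ENNReal.coe_mul, ENNReal.coe_toNNReal hqfin, hqint]
    refine mul_le_mul_left ?_ _
    exact_mod_cast Finset.single_le_sum (f := fun i => ∑ j, ‖A i j‖₊) (fun _ _ => zero_le)
      (Finset.mem_univ i)
  obtain ⟨V, c, hVm, hVc, hV⟩ := D.exists_fixedPoint A hM hAη
  set h : ℝ → ℂ := D.forcing V with hh
  have hhm : AEStronglyMeasurable h := D.aestronglyMeasurable_forcing hVm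
  have hhle := D.enorm_forcing_le hVc
  have hwW : ∀ t, w t ≤ (∫⁻ s, ‖q s‖ₑ).toNNReal := fun t =>
    ENNReal.toNNReal_mono hqfin (expAvg_le_lintegral hβ0 q t)
  -- The weight is bounded by `∫ |q|`, so `h` is dominated by a locally integrable combination of
  -- `|q|` and the `|bₖ|`.
  have hhloc : LocallyIntegrable h := by
    set W : ℝ≥0 := (∫⁻ s, ‖q s‖ₑ).toNNReal with hW
    have hnorm : ∀ {f : ℝ → ℂ}, LocallyIntegrable f → LocallyIntegrable fun s => (‖f s‖ : ℂ) :=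
      fun hf x => let ⟨U, hU, hi⟩ := hf x; ⟨U, hU, hi.norm.ofReal⟩
    have hdom : LocallyIntegrable fun s => ((1 + c * D.η : ℝ≥0) : ℂ) * (‖q s‖ : ℂ) +
        ∑ k, ((c * W : ℝ≥0) : ℂ) * (‖D.b k s‖ : ℂ) :=
      ((hnorm hqi.locallyIntegrable).smul ((1 + c * D.η : ℝ≥0) : ℂ)).add
        (locallyIntegrable_sum _ fun k _ =>
          (hnorm (((hpl (k + 1)).smul ((((k : ℕ) + 1).factorial : ℂ))⁻¹))).smul
            ((c * W : ℝ≥0) : ℂ))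
    refine hdom.mono hhm (Eventually.of_forall fun s => ?_)
    have h1 : ‖h s‖₊ ≤ (1 + c * D.η) * ‖q s‖₊ + ∑ k, c * (‖D.b k s‖₊ * w s) := by
      have := hhle s
      simp only [enorm_eq_nnnorm] at this
      exact_mod_cast this
    have h2 : ‖h s‖₊ ≤ (1 + c * D.η) * ‖q s‖₊ + ∑ k, (c * W) * ‖D.b k s‖₊ := by
      refine h1.trans (add_le_add_right (Finset.sum_le_sum fun k _ => ?_) _)
      rw [mul_assoc, mul_comm W]
      exact mul_le_mul_right (mul_le_mul_right (hwW s) _) _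
    have h3 : (((1 + c * D.η : ℝ≥0) : ℂ) * (‖q s‖ : ℂ) +
        ∑ k, ((c * W : ℝ≥0) : ℂ) * (‖D.b k s‖ : ℂ)) =
        (((1 + c * D.η) * ‖q s‖₊ + ∑ k, (c * W) * ‖D.b k s‖₊ : ℝ≥0) : ℝ) := by
      push_cast; rfl
    rw [h3, Complex.norm_real, Real.norm_of_nonneg (NNReal.coe_nonneg _)]
    exact_mod_cast h2
  have hgi : ∀ j t, Integrable fun s => greenKernel (γ j) t s * h s := fun j t =>
    D.integrable_mul hhm hhle j t
  set x : Fin m → ℝ → ℂ := fun j t =>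
    (gammaProd γ j)⁻¹ * ∫ s, greenKernel (γ j) t s * h s with hx
  set u : ℝ → ℂ := fun t => 1 - ∫ τ in Ioi t, V τ 0 with hu
  have hVx : ∀ t i, V t i = ∑ j, γ j ^ (i : ℕ) * x j t := fun t i => by
    rw [hV]
    exact Finset.sum_congr rfl fun j _ => by rw [hA, hx]; exact mul_assoc _ _ _
  have hVi : Integrable fun t => V t 0 := D.integrable_of_le hVm hVc 0
  -- One constant for both bounds: `c` handles `u - 1`, the `j`-th summand handles `xⱼ`.
  refine ⟨T, hT, u, x, h, c + ∑ j, ‖(gammaProd γ j)⁻¹‖₊ * ((1 + c * D.η) + c * ∑ k, D.M j k),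
    ?_, fun j => ?_, fun t ht => ?_, fun j t => ?_, fun t => ?_⟩
  · have h1 : (fun t => ∑ j, x j t) = fun t => V t 0 := funext fun t => by
      rw [hVx]; simp
    rw [h1]
    refine ⟨hVi.locallyIntegrable, fun a b => ?_⟩
    rw [← intervalIntegral.integral_Ioi_sub_Ioi' hVi.integrableOn hVi.integrableOn, hu]
    ring
  · exact ((isPrimitive_greenKernel (hre j) hhloc (hgi j)).const_mul (gammaProd γ j)⁻¹).congr
      (fun t => rfl) fun t => by rw [hx]; ring
  · have hqt : q t = pertDeriv r lam 0 t := indicator_of_mem (show t ∈ Ici T from ht.le) _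
    have hpt : ∀ k, p k t = pertDeriv r lam k t := fun k =>
      indicator_of_mem (show t ∈ Ici t₀ from hT.trans ht.le) _
    simp only [← hVx, ← hqt, ← hpt, div_eq_inv_mul]
    rfl
  · have h1 := mul_le_mul_right (D.nnnorm_integral_mul_le hhle j t) ‖(gammaProd γ j)⁻¹‖₊
    rw [← nnnorm_mul] at h1
    refine le_trans ?_ (mul_le_mul_right (hwd t) _)
    rw [enorm_eq_nnnorm]
    norm_cast
    refine h1.trans ?_
    rw [← mul_assoc]
    refine mul_le_mul_left (le_add_left ?_) _
    exact Finset.single_le_sum (f := fun j => ‖(gammaProd γ j)⁻¹‖₊ *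
      ((1 + c * D.η) + c * ∑ k, D.M j k)) (fun _ _ => zero_le) (Finset.mem_univ j)
  · have h1 : u t - 1 = -∫ τ in Ioi t, V τ 0 := by rw [hu]; ring
    rw [h1, enorm_neg]
    refine (enorm_integral_le_lintegral_enorm _).trans ?_
    rw [← lintegral_const_mul' _ _ ENNReal.coe_ne_top]
    refine lintegral_mono fun s => ?_
    refine le_trans ?_ (mul_le_mul' (ENNReal.coe_le_coe.mpr le_self_add) (hwd s))
    change (‖V s 0‖₊ : ℝ≥0∞) ≤ c * D.w s
    exact_mod_cast (nnnorm_le_pi_nnnorm (V s) 0).trans (hVc s)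

/-! ### The solution and its asymptotics -/

/-- A solution on `[t₀,∞)` whose derivatives agree with `jet` to the right of `T`. -/
theorem exists_isSolution_eq_jet {m : ℕ} (hm : 0 < m) {t₀ T : ℝ} (hT : t₀ ≤ T)
    {a : Fin (m + 1) → ℂ} {r : Fin (m + 1) → ℝ → ℂ}
    (hr : ∀ i, LocallyIntegrableOn (r i) (Ici t₀)) {lam : ℂ} {γ : Fin m → ℂ}
    (hlam : (charPoly a).IsRoot lam) (hmu : ∀ j, (charPoly a).IsRoot (γ j + lam))
    (hγ : Function.Injective γ) (hγ0 : ∀ j, γ j ≠ 0) {u h : ℝ → ℂ} {x : Fin m → ℝ → ℂ}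
    (hu : IsPrimitive u fun t => ∑ j, x j t)
    (hx : ∀ j, IsPrimitive (x j) fun t => γ j * x j t + (gammaProd γ j)⁻¹ * h t)
    (hh : ∀ t, T < t → h t = -(pertDeriv r lam 0 t * u t + ∑ k : Fin m,
      pertDeriv r lam (k + 1) t / ((k : ℕ) + 1).factorial * ∑ j, γ j ^ (k : ℕ) * x j t)) :
    ∃ y, IsSolution a r t₀ y ∧ ∀ i ≤ m, ∀ t, T ≤ t →
      iteratedDerivWithin i y (Ici t₀) t = jet lam γ t₀ u x i t := by
  set R : Fin (m + 1) → ℝ → ℂ := fun i => (Ici t₀).indicator (r i) with hR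
  set A : Fin (m + 1) → Fin (m + 1) → ℝ → ℂ := fun i j t =>
    if (i : ℕ) = m then -(a j + R j t) else if (j : ℕ) = i + 1 then 1 else 0 with hA
  have hAl : ∀ i j, LocallyIntegrable (A i j) := fun i j => by
    by_cases hi : (i : ℕ) = m
    · simp only [hA, if_pos hi]
      exact ((locallyIntegrable_const _).add (locallyIntegrable_indicator_Ici (hr j))).neg
    · simp only [hA, if_neg hi]
      exact locallyIntegrable_const _
  have hAsum : ∀ (Y : ℕ → ℝ → ℂ) (i : Fin (m + 1)) (t : ℝ), ∑ j, A i j t * Y j t =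
      if (i : ℕ) = m then -∑ j, (a j + R j t) * Y j t else Y (i + 1) t := fun Y i t => by
    by_cases hi : (i : ℕ) = m
    · simp only [hA, if_pos hi, neg_mul, Finset.sum_neg_distrib]
    · simp only [hA, if_neg hi]
      have hlt : (i : ℕ) + 1 < m + 1 := by have := i.2; omega
      rw [Finset.sum_eq_single ⟨i + 1, hlt⟩]
      · simp
      · intro j _ hj
        rw [if_neg fun h' => hj (Fin.ext h'), zero_mul]
      · simp
  obtain ⟨X, hXT, hXp⟩ := exists_extension hAl hT
    (Z := fun i => jet lam γ t₀ u x i)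
    (fun i => isPrimitive_jet hm hγ hγ0 hu hx (Nat.lt_succ_iff.mp i.2)) fun i t ht => by
      rw [hAsum]
      split_ifs with hi
      · have h1 : ∀ j, R j t = r j t := fun j =>
          indicator_of_mem (show t ∈ Ici t₀ from hT.trans ht.le) _
        simp only [h1, add_mul, Finset.sum_add_distrib]
        rw [hi, sum_pert_mul_jet t₀ u x hγ0, jet_top_eq t₀ u x hlam hmu, hh t ht]
        ring
      · rw [add_zero]
  set Y : ℕ → ℝ → ℂ := fun i => if hi : i < m + 1 then X ⟨i, hi⟩ else 0 with hY
  have hYX : ∀ i : Fin (m + 1), Y i = X i := fun i => dif_pos i.2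
  have hYp : ∀ i : Fin (m + 1), IsPrimitive (Y i) ((Ioi t₀).indicator fun t =>
      if (i : ℕ) = m then -∑ j, (a j + R j t) * Y j t else Y (i + 1) t) := fun i => by
    rw [hYX]
    convert! hXp i using 2
    funext t
    rw [← hAsum]
    simp only [hYX]
  obtain ⟨hsol, hder⟩ := isSolution_of_isPrimitive a r t₀ Y
    (fun i hi => by simpa [hi.ne] using hYp ⟨i, by omega⟩)
    ((hYp (Fin.last m)).congr (fun t => rfl) fun t => by
      by_cases ht : t ∈ Ioi t₀
      · have h1 : ∀ j, R j t = r j t := fun j =>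
          indicator_of_mem (show t ∈ Ici t₀ from Ioi_subset_Ici_self ht) _
        rw [indicator_of_mem ht, indicator_of_mem ht, Fin.val_last, if_pos rfl]
        simp only [h1]
      · rw [indicator_of_notMem ht, indicator_of_notMem ht])
  refine ⟨Y 0, hsol, fun i hi t ht => ?_⟩
  rw [hder i hi t (hT.trans ht)]
  have h1 := hXT ⟨i, Nat.lt_succ_iff.mpr hi⟩ t ht
  rw [← hYX] at h1
  exact h1

/-- The Levinson type theorem, with the order of the equation written as `m + 1`. -/
theorem exists_levinson_solution {m : ℕ} (hm : 0 < m) (t₀ : ℝ) (a : Fin (m + 1) → ℂ)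
    (r : Fin (m + 1) → ℝ → ℂ) (hr : ∀ i, LocallyIntegrableOn (r i) (Ici t₀)) (lam : ℂ)
    (mu : Fin m → ℂ) (hlam : (charPoly a).IsRoot lam) (hmu : ∀ j, (charPoly a).IsRoot (mu j))
    (hre : ∀ j, (mu j).re ≠ lam.re) (hinj : Function.Injective fun j => (mu j).re)
    (hP : IntegrableOn (pertDeriv r lam 0) (Ici t₀)) (β : ℝ) (hβ0 : 0 < β)
    (hβ : ∀ j, β < |(mu j - lam).re|)
    (hcl : smallness t₀ r lam (fun j : Fin m => mu j - lam) β < 1 / 2) :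
    ∃ y : ℝ → ℂ, IsSolution a r t₀ y ∧
      (∀ᶠ t in atTop, y t ≠ 0) ∧
      (∀ i ∈ Finset.Icc 1 m,
        Tendsto (fun t => iteratedDerivWithin i y (Ici t₀) t / y t) atTop (𝓝 (lam ^ i))) ∧
      (∃ ε : ℝ → ℂ,
        (ε =O[atTop] fun t => (∫⁻ s in Ioi t, dichInt t₀ β (pertDeriv r lam 0) s).toReal) ∧
        ∀ t, t₀ ≤ t → y t = (1 + ε t) * Complex.exp (lam * ((t : ℂ) - (t₀ : ℂ)))) ∧
      (∀ i ∈ Finset.Icc 1 m,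
        (fun t => iteratedDerivWithin i y (Ici t₀) t / y t - lam ^ i) =O[atTop]
          fun t => (dichInt t₀ β (pertDeriv r lam 0) t).toReal) := by
  set γ : Fin m → ℂ := fun j => mu j - lam with hγdef
  have hγ : Function.Injective γ := fun i j hij =>
    hinj (congrArg Complex.re (sub_left_injective hij))
  have hγ0 : ∀ j, γ j ≠ 0 := fun j h => hre j (by
    have := congrArg Complex.re h
    simp only [hγdef, Complex.sub_re, Complex.zero_re] at this
    linarith)
  have hmu' : ∀ j, (charPoly a).IsRoot (γ j + lam) := fun j => by
    rw [hγdef]; simpa using hmu j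
  obtain ⟨T, hT, u, x, h, C, hu, hx, hh, hxle, hule⟩ :=
    exists_coordinates hm hr hγ hP hβ0 hβ hcl
  obtain ⟨y, hsol, hjet⟩ := exists_isSolution_eq_jet hm hT hr hlam hmu' hγ hγ0 hu hx hh
  set d : ℝ → ℝ≥0∞ := dichInt t₀ β (pertDeriv r lam 0) with hd
  set p : ℝ → ℂ := (Ici t₀).indicator (pertDeriv r lam 0) with hp
  have hpi : Integrable p := by rwa [hp, integrable_indicator_iff measurableSet_Ici]
  have hdp : d = expAvg β p := funext fun t => dichInt_eq_expAvg hβ0 hpi.1 t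
  have hdfin : ∀ t, d t ≠ ∞ := fun t => by
    rw [hdp]
    exact ((expAvg_le_lintegral hβ0 p t).trans_lt hpi.2).ne
  have hd0 : Tendsto (fun t => (d t).toReal) atTop (𝓝 0) := by
    rw [hdp]
    exact (ENNReal.tendsto_toReal ENNReal.zero_ne_top).comp (tendsto_expAvg hβ0 hpi)
  have hdint : ∫⁻ t, d t ≠ ∞ := by
    obtain ⟨C₀, hC₀⟩ := exists_lintegral_expAvg_le hβ0
    rw [hdp]
    exact ((hC₀ p hpi.1).trans_lt (ENNReal.mul_lt_top ENNReal.coe_lt_top hpi.2)).ne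
  have hdm : AEMeasurable d := hdp ▸ aemeasurable_expAvg β hpi.1
  have htailfin : ∀ t, ∫⁻ s in Ioi t, d s ≠ ∞ := fun t =>
    ((setLIntegral_le_lintegral _ _).trans_lt hdint.lt_top).ne
  have htail0 : Tendsto (fun t => (∫⁻ s in Ioi t, d s).toReal) atTop (𝓝 0) := by
    have h1 : Tendsto (fun t => ∫⁻ s in Ioi t, d s) atTop (𝓝 0) :=
      (tendsto_setLIntegral_Ici hdm hdint).congr fun t => setLIntegral_congr Ioi_ae_eq_Ici.symm
    exact (ENNReal.tendsto_toReal ENNReal.zero_ne_top).comp h1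
  have hreal : ∀ {z : ℂ} {b : ℝ≥0∞}, b ≠ ∞ → ‖z‖ₑ ≤ C * b → ‖z‖ ≤ C * b.toReal := by
    intro z b hb hz
    have := ENNReal.toReal_mono (ENNReal.mul_ne_top ENNReal.coe_ne_top hb) hz
    simpa [ENNReal.toReal_mul] using this
  have hu1 : ∀ t, ‖u t - 1‖ ≤ C * (∫⁻ s in Ioi t, d s).toReal := fun t =>
    hreal (htailfin t) (hule t)
  have hx1 : ∀ j t, ‖x j t‖ ≤ C * (d t).toReal := fun j t => hreal (hdfin t) (hxle j t)
  have hulim : Tendsto u atTop (𝓝 1) := by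
    rw [tendsto_iff_norm_sub_tendsto_zero]
    exact squeeze_zero (fun _ => norm_nonneg _) hu1 (by simpa using htail0.const_mul (C : ℝ))
  have hy : ∀ t, T ≤ t → y t = Complex.exp (lam * ((t : ℂ) - t₀)) * u t := fun t ht => by
    rw [← jet_zero (γ := γ) t₀ u x t, ← hjet 0 m.zero_le t ht, iteratedDerivWithin_zero]
  have hu0 : ∀ᶠ t in atTop, u t ≠ 0 := hulim.eventually_ne one_ne_zero
  -- The exponential cancels in the quotient, and subtracting `λⁱ` leaves only the `xⱼ`, divided by
  -- `u → 1`.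
  have hratio : ∀ i ∈ Finset.Icc 1 m, ∀ᶠ t in atTop,
      iteratedDerivWithin i y (Ici t₀) t / y t - lam ^ i =
        (∑ j, ((γ j + lam) ^ i - lam ^ i) / γ j * x j t) / u t := by
    intro i hi
    filter_upwards [hu0, eventually_ge_atTop T] with t h1 h2
    rw [hjet i (Finset.mem_Icc.mp hi).2 t h2, hy t h2, jet,
      mul_div_mul_left _ _ (Complex.exp_ne_zero _)]
    field_simp
    ring
  have hO : ∀ i ∈ Finset.Icc 1 m,
      (fun t => iteratedDerivWithin i y (Ici t₀) t / y t - lam ^ i) =O[atTop]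
        fun t => (d t).toReal := by
    intro i hi
    refine IsBigO.congr' (f₁ := fun t =>
      (∑ j, ((γ j + lam) ^ i - lam ^ i) / γ j * x j t) * (u t)⁻¹)
      (g₁ := fun t => (d t).toReal * 1) ?_ ?_ (Eventually.of_forall fun t => mul_one _)
    · refine IsBigO.mul (IsBigO.fun_sum fun j _ => IsBigO.const_mul_left ?_ _)
        ((hulim.inv₀ one_ne_zero).isBigO_one ℝ)
      exact IsBigO.of_bound (C : ℝ) (Eventually.of_forall fun t => by
        rw [Real.norm_of_nonneg ENNReal.toReal_nonneg]
        exact hx1 j t)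
    · filter_upwards [hratio i hi] with t ht
      rw [ht, div_eq_mul_inv]
  -- `ε` is defined by the claimed identity on the whole line, so only its size for `t ≥ T`, where
  -- it equals `u - 1`, needs an argument.
  refine ⟨y, hsol, ?_, fun i hi => ?_,
    ⟨fun t => y t / Complex.exp (lam * ((t : ℂ) - t₀)) - 1, ?_, fun t _ => ?_⟩, hO⟩
  · filter_upwards [hu0, eventually_ge_atTop T] with t h1 h2
    rw [hy t h2]
    exact mul_ne_zero (Complex.exp_ne_zero _) h1
  · exact tendsto_sub_nhds_zero_iff.mp ((hO i hi).trans_tendsto hd0)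
  · refine IsBigO.of_bound (C : ℝ) ?_
    filter_upwards [eventually_ge_atTop T] with t ht
    rw [Real.norm_of_nonneg ENNReal.toReal_nonneg, hy t ht,
      mul_div_cancel_left₀ _ (Complex.exp_ne_zero _)]
    exact hu1 t
  · rw [add_sub_cancel, div_mul_cancel₀ _ (Complex.exp_ne_zero _)]

end PoincarePerron

theorem mainTheorem5 (n : ℕ) (hn : 2 ≤ n) (t₀ : ℝ)
    (a : Fin n → ℂ) (r : Fin n → ℝ → ℂ)
    (hr : ∀ i, LocallyIntegrableOn (r i) (Ici t₀))
    (lam : ℂ) (mu : Fin (n - 1) → ℂ)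
    (hlam : (charPoly a).IsRoot lam) (hmu : ∀ j, (charPoly a).IsRoot (mu j))
    (hre : ∀ j, (mu j).re ≠ lam.re)
    (hinj : Function.Injective fun j => (mu j).re)
    (hP : IntegrableOn (pertDeriv r lam 0) (Ici t₀))
    (β : ℝ) (hβ0 : 0 < β) (hβ : ∀ j, β < |(mu j - lam).re|)
    (hcl : smallness t₀ r lam (fun j => mu j - lam) β < 1 / 2) :
    ∃ y : ℝ → ℂ, IsSolution a r t₀ y ∧
      (∀ᶠ t in atTop, y t ≠ 0) ∧
      (∀ i ∈ Finset.Icc 1 (n - 1),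
        Tendsto (fun t => iteratedDerivWithin i y (Ici t₀) t / y t) atTop (𝓝 (lam ^ i))) ∧
      (∃ ε : ℝ → ℂ,
        (ε =O[atTop] fun t => (∫⁻ s in Ioi t, dichInt t₀ β (pertDeriv r lam 0) s).toReal) ∧
        ∀ t, t₀ ≤ t → y t = (1 + ε t) * Complex.exp (lam * ((t : ℂ) - (t₀ : ℂ)))) ∧
      (∀ i ∈ Finset.Icc 1 (n - 1),
        (fun t => iteratedDerivWithin i y (Ici t₀) t / y t - lam ^ i) =O[atTop]
          fun t => (dichInt t₀ β (pertDeriv r lam 0) t).toReal) := by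
  obtain ⟨m, rfl⟩ : ∃ m, n = m + 1 := ⟨n - 1, by omega⟩
  exact exists_levinson_solution (by omega) t₀ a r hr lam mu hlam hmu hre hinj hP β hβ0 hβ hcl
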